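/- **Setting.** Let $\mathcal X,\mathcal S,\mathcal A$ be countable. An MDP $M$ with horizon $H$ over a state space $\mathcal X$ has an initial distribution $P_0\in\Delta(\mathcal X)$, transitions $P_h:\mathcal X\times\mathcal A\to\Delta(\mathcal X)$ and rewards $R_h:\mathcal X\times\mathcal A\to\Delta([0,1])$, $1\le h\le H$; a policy $\pi=(\pi_h)_{h\le H}$, $\pi_h:\mathcal X\to\Delta(\mathcal A)$, generates $x_1\sim P_0$, $a_h\sim\pi_h(x_h)$, $r_h\sim R_h(x_h,a_h)$, $x_{h+1}\sim P_h(x_h,a_h)$. Write $M_h(x,a)=R_h(x,a)\otimes P_h(x,a)$ for the joint law of $(r_h,x_{h+1})$ and $M_0=P_0$, $J^M(\pi)=\mathbb E^{M,\pi}[\sum_{h=1}^H r_h]$ and $J^M_\star=\sup_\pi J^M(\pi)$ (this is $J^M(\pi_M)$ for an optimal policy $\pi_M$). Let $M^\star_{\rm lat}$ be an MDP over $\mathcal S$, let $\psi^\star=(\psi^\star_h:\mathcal S\to\Delta(\mathcal X))_{h\le H+1}$ be a decodable emission process (for each $h$, distinct states have emissions with disjoint supports) with decoder $\phi^\star=(\psi^\star)^{-1}$,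 and let $M^\star_{\rm obs}$ be the latent-dynamics MDP over $\mathcal X$ with initial state $x_1\sim\psi^\star_1(s_1)$, $s_1\sim P^\star_{{\rm lat},0}$, reward law $R^\star_{{\rm lat},h}(\phi^\star_h(x_h),a_h)$, and next state $x_{h+1}\sim\psi^\star_{h+1}(s')$, $s'\sim P^\star_{{\rm lat},h}(\phi^\star_h(x_h),a_h)$. Let $\mathcal M_{\rm lat}$ be a class of MDPs over $\mathcal S$ with actions $\mathcal A$ and horizon $H$, and $\Phi$ a class of decoders $\phi=(\phi_h:\mathcal X\to\mathcal S)_{h\le H+1}$. In $M^\star_{\rm obs}$ and in every $M\in\mathcal M_{\rm lat}$, assume $\sum_{h=1}^H r_h\in[0,1]$ almost surely under every policy. **Base algorithm.** A base algorithm $\mathrm{Alg}$ for $K$ episodes is a (possibly randomized) rule which in each episode chooses a policy $\mathcal S\times[H]\to\Delta(\mathcal A)$ from the policies and trajectories of the earlier episodes, and which outputs a final policy $\hat\pi$ after $K$ episodes. $\mathrm{Risk}_{\rm base}(K)=\sup_{M\in\mathcal M_{\rm lat}}\mathbb E\big[J^M_\star-J^M(\hat\pi)\big]$, where $\mathrm{Alg}$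 is run in $M$ with its states observed. **Oracle.** A representation learning oracle, in each round $t\le T$, chooses (possibly at random) a pair $(\widehat M^{t},\widehat\phi^{t})$ from the trajectories collected in rounds $1,\dots,t-1$ and its earlier outputs. It is *proper* if always $\widehat M^t\in\mathcal M_{\rm lat}$ and $\widehat\phi^t\in\Phi$. With $D_H^2(P,Q)=\int(\sqrt{dP/d\nu}-\sqrt{dQ/d\nu})^2d\nu$, let $$\Delta_h(M,\phi)(x,a)=D_H^2\big(M_h(\phi_h(x),a),\,[\phi_{h+1}\sharp M^\star_{{\rm obs},h}](x,a)\big)\quad(0\le h\le H),$$ where $\phi_{h+1}\sharp M^\star_{{\rm obs},h}(x,a)$ is the law of $(r,\phi_{h+1}(x'))$ for $(r,x')\sim M^\star_{{\rm obs},h}(x,a)$, and for $h=0$ the initial laws of $M$ and of $\phi_1(x_1)$ are compared. In the online protocol, in each round $t$ the oracle outputs $(\widehat M^t,\widehat\phi^t)$, a distribution $p^t$ over policies $\mathcal X\times[H]\to\Delta(\mathcal A)$ is chosen adaptively (as a function of everything that happened before, including $(\widehat M^t,\widehat\phi^t)$), and a trajectory is collected in $M^\star_{\rm obs}$ with $\pi^t\sim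 p^t$. The optimistic self-predictive regret is $$\mathrm{Reg}(T,\gamma)=\sum_{t=1}^T\Big(\sum_{h=0}^H\mathbb E_{\pi\sim p^t}\mathbb E^{M^\star_{\rm obs},\pi}\big[\Delta_h(\widehat M^t,\widehat\phi^t)(x_h,a_h)\big]+\gamma^{-1}\big(J^{M^\star_{\rm lat}}_\star-J^{\widehat M^t}_\star\big)\Big).$$ **O2L.** In each epoch $t=1,\dots,T$: the oracle outputs $(\widehat M^t,\widehat\phi^t)$; a new instance of $\mathrm{Alg}$ is run for $K$ episodes, where in each episode its policy $\pi$ is deployed as $\pi\circ\widehat\phi^t$ in $M^\star_{\rm obs}$ and $\mathrm{Alg}$ receives the trajectory with every $x_h$ replaced by $\widehat\phi^t_h(x_h)$; its final policy $\hat\pi^t$ is deployed as $\hat\pi^t\circ\widehat\phi^t$ for one more episode; one of the $K+1$ trajectories of the epoch, chosen uniformly at random, is passed to the oracle. The output $\hat\pi$ is the uniform mixture of $\hat\pi^1\circ\widehat\phi^1,\dots,\hat\pi^T\circ\widehat\phi^T$, and $\mathrm{Risk}_{\rm obs}(TK)=J^{M^\star_{\rm obs}}_\star-J^{M^\star_{\rm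 obs}}(\hat\pi)$. **Theorem (risk bound for O2L under self-predictive estimation).** There are absolute constants $c_1,c_2,c_3>0$ such that, in the setting above, for all $T,K\ge1$ and $\gamma>0$ and every base algorithm $\mathrm{Alg}$: if the oracle is proper and, for every adaptive sequence $p^1,\dots,p^T$, satisfies $\mathbb E[\mathrm{Reg}(T,\gamma)]\le\mathrm{Est}(T,\gamma)$, then $$\mathbb E[\mathrm{Risk}_{\rm obs}(TK)]\le c_1\,\mathrm{Risk}_{\rm base}(K)+c_2\,\gamma\,\frac KT\,\mathrm{Est}(T,\gamma)+c_3\,\gamma^{-1}KH .$$ -/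

import Mathlib

open MeasureTheory ProbabilityTheory
open scoped ENNReal

noncomputable section

namespace LatentRL

/-! ### Squared Hellinger distance -/

/-- Squared Hellinger distance `∫ (√(dP/dν) - √(dQ/dν))² dν`, with dominating measure `ν = P + Q`. -/
def hellingerSq {Ω : Type*} [MeasurableSpace Ω] (P Q : Measure Ω) : ℝ :=
  ∫ ω, (√(P.rnDeriv (P + Q) ω).toReal - √(Q.rnDeriv (P + Q) ω).toReal) ^ 2 ∂(P + Q)

/-! ### Markov decision processes, policies, trajectories -/

/-- An episodic MDP with horizon `H`, state space `X`, action space `A`. Step `h ∈ {1, …, H}` is the element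
`h - 1` of `Fin H`. -/
structure MDP (X A : Type*) [MeasurableSpace X] (H : ℕ) where
  /-- initial state distribution -/
  init : ProbabilityMeasure X
  /-- `trans h x a` is the law of the next state -/
  trans : Fin H → X → A → ProbabilityMeasure X
  /-- `rew h x a` is the law of the reward, a distribution on `[0, 1]` -/
  rew : Fin H → X → A → ProbabilityMeasure unitInterval

/-- Models carry the σ-algebra generated by the probabilities of events under their kernels. -/
instance instMeasurableSpaceMDP (X A : Type*) [MeasurableSpace X] (H : ℕ) :
    MeasurableSpace (MDP X A H) :=
  MeasurableSpace.comap (fun M => (M.init, M.trans, M.rew)) inferInstance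

/-- Randomized nonstationary Markov policies. -/
abbrev Policy (X A : Type*) [MeasurableSpace A] (H : ℕ) := Fin H → X → ProbabilityMeasure A

/-- What one step of an episode produces: action, reward, next state. -/
abbrev Step (X A : Type*) := A × unitInterval × X

/-- Trajectories `x₁, (a₁, r₁, x₂), …, (a_H, r_H, x_{H+1})`. -/
abbrev Traj (X A : Type*) (H : ℕ) := X × (Fin H → Step X A)

/-- Decoders `φ₁, …, φ_{H+1} : X → S`. -/
abbrev Decoder (X S : Type*) (H : ℕ) := Fin (H + 1) → X → S

/-- The state at (zero-based) time `i ≤ n` of a trajectory of length `n`. -/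
def Traj.state {X A : Type*} {n : ℕ} (τ : Traj X A n) (i : Fin (n + 1)) : X :=
  Fin.cases τ.1 (fun h => (τ.2 h).2.2) i

/-- Total reward of a trajectory. -/
def Traj.ret {X A : Type*} {H : ℕ} (τ : Traj X A H) : ℝ := ∑ h, ((τ.2 h).2.1 : ℝ)

/-- Compress a trajectory through a decoder. -/
def compress {X S A : Type*} {H : ℕ} (φ : Decoder X S H) (τ : Traj X A H) : Traj S A H :=
  (φ 0 τ.1, fun h => ((τ.2 h).1, (τ.2 h).2.1, φ h.succ (τ.2 h).2.2))

/-- The observation-level policy `π ∘ φ`. -/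
def Policy.comp {X S A : Type*} [MeasurableSpace A] {H : ℕ} (π : Policy S A H)
    (φ : Decoder X S H) : Policy X A H :=
  fun h x => π h (φ h.castSucc x)

/-- Joint law `M_h(r_h, x_{h+1} | x_h, a_h)` of reward and next state. -/
def MDP.joint {X A : Type*} [MeasurableSpace X] {H : ℕ} (M : MDP X A H) (h : Fin H) (x : X)
    (a : A) : Measure (unitInterval × X) :=
  (M.rew h x a : Measure unitInterval).prod (M.trans h x a : Measure X)

instance {X A : Type*} [MeasurableSpace X] {H : ℕ} (M : MDP X A H) (h : Fin H) (x : X) (a : A) :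
    IsProbabilityMeasure (M.joint h x a) := by
  unfold MDP.joint; infer_instance

/-! ### Laws of sequences generated one element at a time -/

/-- The law of `ω₀, …, ω_{n-1}` when `ω_i` is drawn from `κ i` given the parameter `θ` and
`ω₀, …, ω_{i-1}`. -/
def historyKernel {Θ Ω : Type*} [MeasurableSpace Θ] [MeasurableSpace Ω] {N : ℕ}
    (κ : (n : Fin N) → Kernel (Θ × (Fin n → Ω)) Ω) :
    (n : ℕ) → n ≤ N → Kernel Θ (Fin n → Ω)
  | 0, _ => Kernel.const Θ (Measure.dirac (fun i => i.elim0))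
  | n + 1, hn =>
      (historyKernel κ n (Nat.le_of_succ_le hn) ⊗ₖ κ ⟨n, hn⟩).map
        (fun p => (Fin.snoc p.1 p.2 : Fin (n + 1) → Ω))

lemma measurable_snoc {Ω : Type*} [MeasurableSpace Ω] (n : ℕ) :
    Measurable (fun p : (Fin n → Ω) × Ω => (Fin.snoc p.1 p.2 : Fin (n + 1) → Ω)) := by
  refine measurable_pi_lambda _ fun i => ?_
  refine Fin.lastCases ?_ (fun j => ?_) i
  · simpa using measurable_snd
  · have hj : Measurable (fun p : (Fin n → Ω) × Ω => p.1 j) :=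
      (measurable_pi_apply j).comp measurable_fst
    simpa using hj

lemma isMarkovKernel_historyKernel {Θ Ω : Type*} [MeasurableSpace Θ] [MeasurableSpace Ω] {N : ℕ}
    (κ : (n : Fin N) → Kernel (Θ × (Fin n → Ω)) Ω) (hκ : ∀ n, IsMarkovKernel (κ n)) :
    ∀ (n : ℕ) (hn : n ≤ N), IsMarkovKernel (historyKernel κ n hn)
  | 0, _ => by unfold historyKernel; infer_instance
  | n + 1, hn => by
      have := isMarkovKernel_historyKernel κ hκ n (Nat.le_of_succ_le hn)
      have := hκ ⟨n, hn⟩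
      unfold historyKernel
      exact Kernel.IsMarkovKernel.map _ (measurable_snoc n)

set_option linter.unusedSectionVars false

section Discrete

variable {X S A : Type*}
  [MeasurableSpace X] [DiscreteMeasurableSpace X] [Countable X]
  [MeasurableSpace S] [DiscreteMeasurableSpace S] [Countable S]
  [MeasurableSpace A] [DiscreteMeasurableSpace A] [Countable A]
  {H : ℕ}

/-! ### The law of a trajectory -/

/-- `(π, x) ↦ π_h(x)`. -/
def actionKernel (h : Fin H) : Kernel (Policy X A H × X) A where
  toFun q := (q.1 h q.2 : Measure A)
  measurable' := measurable_from_prod_countable_left fun x =>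
    measurable_subtype_coe.comp ((measurable_pi_apply x).comp (measurable_pi_apply h))

instance (h : Fin H) : IsMarkovKernel (actionKernel h : Kernel (Policy X A H × X) A) :=
  ⟨fun q => (q.1 h q.2).2⟩

/-- `((π, x), a) ↦ M_h(r, x' | x, a)`. -/
def outcomeKernel (M : MDP X A H) (h : Fin H) :
    Kernel ((Policy X A H × X) × A) (unitInterval × X) :=
  (Kernel.ofFunOfCountable (fun q : X × A => M.joint h q.1 q.2)).comap
    (fun q => (q.1.2, q.2)) (by fun_prop)

instance (M : MDP X A H) (h : Fin H) : IsMarkovKernel (outcomeKernel M h) :=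
  ⟨fun q => inferInstanceAs (IsProbabilityMeasure (M.joint h q.1.2 q.2))⟩

lemma Traj.measurable_state {n : ℕ} (i : Fin (n + 1)) :
    Measurable (fun τ : Traj X A n => τ.state i) := by
  refine Fin.cases ?_ (fun h => ?_) i
  · exact measurable_fst
  · exact (measurable_snd.comp measurable_snd).comp
      ((measurable_pi_apply h).comp measurable_snd)

/-- Step `h` of an episode played with `π`, from the last state of the trajectory so far:
`a_h ∼ π_h(x_h)`, `r_h ∼ R_h(x_h, a_h)`, `x_{h+1} ∼ P_h(x_h, a_h)`. -/
def stepKernel (M : MDP X A H) (h : Fin H) :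
    Kernel ((Policy X A H × X) × (Fin h → Step X A)) (Step X A) :=
  (actionKernel h ⊗ₖ outcomeKernel M h).comap
    (fun q => (q.1.1, Traj.state (q.1.2, q.2) (Fin.last h)))
    ((measurable_fst.comp measurable_fst).prodMk ((Traj.measurable_state (Fin.last (h : ℕ))).comp
      ((measurable_snd.comp measurable_fst).prodMk measurable_snd)))

instance (M : MDP X A H) (h : Fin H) : IsMarkovKernel (stepKernel M h) := by
  unfold stepKernel; infer_instance

/-- The law of the trajectory in `M`, as a function of the policy played. -/
def trajKernel (M : MDP X A H) : Kernel (Policy X A H) (Traj X A H) :=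
  Kernel.const _ (M.init : Measure X) ⊗ₖ historyKernel (stepKernel M) H le_rfl

instance (M : MDP X A H) : IsMarkovKernel (trajKernel M) := by
  have := isMarkovKernel_historyKernel (stepKernel M) (fun _ => inferInstance) H le_rfl
  unfold trajKernel; infer_instance

/-- Expected total reward `J^M(π)`. -/
def value (M : MDP X A H) (π : Policy X A H) : ℝ := ∫ τ, τ.ret ∂(trajKernel M π)

/-- Optimal expected total reward `J^M(π_M) = sup_π J^M(π)`. -/
def optValue (M : MDP X A H) : ℝ := ⨆ π : Policy X A H, value M π

/-- The total reward is almost surely at most one (it is nonnegative by definition). -/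
def BoundedReturn (M : MDP X A H) : Prop :=
  ∀ π : Policy X A H, ∀ᵐ τ ∂(trajKernel M π), τ.ret ≤ 1

/-! ### Latent-dynamics MDPs -/

/-- Emission processes `ψ₁, …, ψ_{H+1} : S → Δ(X)`. -/
abbrev Emission (S X : Type*) [MeasurableSpace X] (H : ℕ) :=
  Fin (H + 1) → S → ProbabilityMeasure X

/-- Distinct latent states have emission distributions with disjoint supports. -/
def Decodable (ψ : Emission S X H) : Prop :=
  ∀ h s s', s' ≠ s →
    Disjoint {x | (ψ h s : Measure X) {x} ≠ 0} {x | (ψ h s' : Measure X) {x} ≠ 0}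

/-- `φ` is a decoder `ψ⁻¹` associated with `ψ`: it returns `s` on the support of `ψ_h(s)`. -/
def IsDecoder (ψ : Emission S X H) (φ : Decoder X S H) : Prop :=
  ∀ h s x, (ψ h s : Measure X) {x} ≠ 0 → φ h x = s

/-- The latent-dynamics MDP `⟨M, ψ⟩`, where `φ` is the decoder of `ψ`: from `(x, a)` the reward is
drawn from `R_h(φ_h(x), a)` and the next observation from `ψ_{h+1}(s')`,
`s' ∼ P_h(φ_h(x), a)`. -/
def latentDynamics (M : MDP S A H) (ψ : Emission S X H) (φ : Decoder X S H) : MDP X A H where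
  init := ⟨(M.init : Measure S).bind (fun s => (ψ 0 s : Measure X)),
    isProbabilityMeasure_bind (Measurable.of_discrete).aemeasurable
      (Filter.Eventually.of_forall fun s => (ψ 0 s).2)⟩
  trans h x a := ⟨(M.trans h (φ h.castSucc x) a : Measure S).bind
      (fun s => (ψ h.succ s : Measure X)),
    isProbabilityMeasure_bind (Measurable.of_discrete).aemeasurable
      (Filter.Eventually.of_forall fun s => (ψ h.succ s).2)⟩
  rew h x a := M.rew h (φ h.castSucc x) a

/-! ### Base algorithms and their interaction with `φ`-compressed dynamics -/

/-- A (randomized) base algorithm for `K` episodes: from the policies and latent trajectories of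
episodes `0, …, k-1` it draws the policy of episode `k` if `k < K`, and its final policy if
`k = K`. -/
structure BaseAlg (S A : Type*) [MeasurableSpace S] [MeasurableSpace A] (H K : ℕ) where
  policy : (k : Fin (K + 1)) →
    Kernel (Fin k → Policy S A H × Traj S A H) (Policy S A H)
  isMarkov : ∀ k, IsMarkovKernel (policy k)

lemma measurable_compress :
    Measurable (fun q : Decoder X S H × Traj X A H => compress q.1 q.2) := by
  have key : ∀ i : Fin (H + 1), Measurable (fun q : Decoder X S H × X => q.1 i q.2) := fun i =>
    measurable_from_prod_countable_left fun x =>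
      (measurable_pi_apply x).comp (measurable_pi_apply i)
  refine Measurable.prodMk ((key 0).comp
    (measurable_fst.prodMk (measurable_fst.comp measurable_snd)))
    (measurable_pi_lambda _ fun h => ?_)
  have hs : Measurable (fun q : Decoder X S H × Traj X A H => q.2.2 h) :=
    (measurable_pi_apply h).comp (measurable_snd.comp measurable_snd)
  exact (measurable_fst.comp hs).prodMk (((measurable_fst.comp measurable_snd).comp hs).prodMk
    ((key h.succ).comp (measurable_fst.prodMk ((measurable_snd.comp measurable_snd).comp hs))))

lemma measurable_policy_comp :
    Measurable (fun q : Decoder X S H × Policy S A H => Policy.comp q.2 q.1) := by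
  refine measurable_pi_lambda _ fun h => measurable_pi_lambda _ fun x => ?_
  have e : Measurable (fun q : Policy S A H × S => q.1 h q.2) :=
    measurable_from_prod_countable_left fun s =>
      (measurable_pi_apply s).comp (measurable_pi_apply h)
  have d : Measurable (fun q : Decoder X S H × Policy S A H => q.1 h.castSucc x) :=
    (measurable_pi_apply x).comp ((measurable_pi_apply h.castSucc).comp measurable_fst)
  exact e.comp (measurable_snd.prodMk d)

/-- What the base algorithm remembers: latent policies and compressed trajectories. -/
def compressHistory {n : ℕ} (φ : Decoder X S H) (w : Fin n → Policy S A H × Traj X A H) :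
    Fin n → Policy S A H × Traj S A H :=
  fun i => ((w i).1, compress φ (w i).2)

lemma measurable_compressHistory {n : ℕ} :
    Measurable (fun q : Decoder X S H × (Fin n → Policy S A H × Traj X A H) =>
      compressHistory q.1 q.2) := by
  refine measurable_pi_lambda _ fun i => ?_
  have hi : Measurable (fun q : Decoder X S H × (Fin n → Policy S A H × Traj X A H) => q.2 i) :=
    (measurable_pi_apply i).comp measurable_snd
  exact (measurable_fst.comp hi).prodMk
    (measurable_compress.comp (measurable_fst.prodMk (measurable_snd.comp hi)))

/-- Episode `k`: the base algorithm draws a latent policy `π` from its compressed history, and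
`π ∘ φ` is played in `M`. -/
def episodeKernel {K : ℕ} (alg : BaseAlg S A H K) (M : MDP X A H) (k : Fin (K + 1)) :
    Kernel (Decoder X S H × (Fin k → Policy S A H × Traj X A H)) (Policy S A H × Traj X A H) :=
  ((alg.policy k).comap (fun q => compressHistory q.1 q.2) measurable_compressHistory) ⊗ₖ
    ((trajKernel M).comap
      (fun q : (Decoder X S H × (Fin k → Policy S A H × Traj X A H)) × Policy S A H =>
        Policy.comp q.2 q.1.1)
      (measurable_policy_comp.comp
        ((measurable_fst.comp measurable_fst).prodMk measurable_snd)))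

instance {K : ℕ} (alg : BaseAlg S A H K) (M : MDP X A H) (k : Fin (K + 1)) :
    IsMarkovKernel (episodeKernel alg M k) := by
  have := alg.isMarkov k
  unfold episodeKernel; infer_instance

/-- Run the base algorithm in the `φ`-compressed dynamics of `M`, as a function of `φ`: `K`
episodes, followed by one more in which its final policy is played. Entry `k` holds the latent
policy and the (uncompressed) trajectory of episode `k`; entry `K` holds the final policy. -/
def runKernel {K : ℕ} (alg : BaseAlg S A H K) (M : MDP X A H) :
    Kernel (Decoder X S H) (Fin (K + 1) → Policy S A H × Traj X A H) :=
  historyKernel (episodeKernel alg M) (K + 1) le_rfl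

instance {K : ℕ} (alg : BaseAlg S A H K) (M : MDP X A H) : IsMarkovKernel (runKernel alg M) :=
  isMarkovKernel_historyKernel _ (fun _ => inferInstance) _ _

/-- Expected risk of the base algorithm after `K` episodes in the base MDP `M`, with the states of
`M` observed directly (that is, through the identity decoder). -/
def expectedRisk {K : ℕ} (alg : BaseAlg S A H K) (M : MDP S A H) : ℝ :=
  ∫ w, (optValue M - value M (w (Fin.last K)).1) ∂(runKernel alg M (fun _ s => s))

/-- Worst-case expected risk over a class of base MDPs. -/
def riskBase {K : ℕ} (alg : BaseAlg S A H K) (Mlat : Set (MDP S A H)) : ℝ :=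
  ⨆ M : Mlat, expectedRisk alg M.1

/-! ### Representation learning oracles and optimistic self-predictive regret -/

/-- A (possibly randomized) representation learning oracle for `T` rounds: from its previous
estimates and the trajectories collected in the previous rounds, it draws an estimated base model
and an estimated decoder. -/
structure RepOracle (X S A : Type*) [MeasurableSpace X] [MeasurableSpace S] [MeasurableSpace A]
    (H T : ℕ) where
  estimate : (t : Fin T) →
    Kernel (Fin t → (MDP S A H × Decoder X S H) × Traj X A H) (MDP S A H × Decoder X S H)
  isMarkov : ∀ t, IsMarkovKernel (estimate t)

/-- The oracle only outputs models in `Mlat` and decoders in `Φ`. -/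
def RepOracle.Proper {T : ℕ} (rep : RepOracle X S A H T) (Mlat : Set (MDP S A H))
    (Φ : Set (Decoder X S H)) : Prop :=
  ∀ t w, ∀ᵐ e ∂(rep.estimate t w), e.1 ∈ Mlat ∧ e.2 ∈ Φ

/-- The pushforward model `[φ_{h+1} ♯ M_h](r, s' | x, a)`. -/
def pushforwardModel (M : MDP X A H) (φ : Decoder X S H) (h : Fin H) (x : X) (a : A) :
    Measure (unitInterval × S) :=
  (M.joint h x a).map (fun q => (q.1, φ h.succ q.2))

/-- Self-predictive error `[Δ_h(M, φ)](x, a)`, for `h ≥ 1`, in the environment `Mobs`. -/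
def selfPredErr (Mobs : MDP X A H) (M : MDP S A H) (φ : Decoder X S H) (h : Fin H) (x : X)
    (a : A) : ℝ :=
  hellingerSq (M.joint h (φ h.castSucc x) a) (pushforwardModel Mobs φ h x a)

/-- Self-predictive error `Δ_0(M, φ)` of the initial state distribution. -/
def selfPredErrInit (Mobs : MDP X A H) (M : MDP S A H) (φ : Decoder X S H) : ℝ :=
  hellingerSq (M.init : Measure S) ((Mobs.init : Measure X).map (φ 0))

/-- `∑_{h=0}^H E^π [Δ_h(M, φ)(x_h, a_h)]`, the expectation being in the environment `Mobs`. -/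
def expectedSelfPredErr (Mobs : MDP X A H) (M : MDP S A H) (φ : Decoder X S H)
    (π : Policy X A H) : ℝ :=
  selfPredErrInit Mobs M φ +
    ∑ h : Fin H, ∫ τ, selfPredErr Mobs M φ h (τ.state h.castSucc) (τ.2 h).1 ∂(trajKernel Mobs π)

/-- What one round of the online protocol leaves behind: the estimate of the oracle, the policy
played, the trajectory collected. -/
abbrev Round (X S A : Type*) [MeasurableSpace X] [MeasurableSpace S] [MeasurableSpace A] (H : ℕ) :=
  (MDP S A H × Decoder X S H) × Policy X A H × Traj X A H

/-- An adaptive choice of policies: `dist t` is the distribution `p_t` of the policy of round `t`,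
a function of the previous rounds and of the estimate of the oracle in round `t`. -/
structure Strategy (X S A : Type*) [MeasurableSpace X] [MeasurableSpace S] [MeasurableSpace A]
    (H T : ℕ) where
  dist : (t : Fin T) →
    Kernel ((Fin t → Round X S A H) × (MDP S A H × Decoder X S H)) (Policy X A H)
  isMarkov : ∀ t, IsMarkovKernel (dist t)

/-- Round `t` of the online protocol: the oracle draws its estimate from its previous estimates
and the trajectories collected so far, a policy is drawn from `p_t`, and a trajectory is collected
with it in `Mobs`. -/
def roundKernel {T : ℕ} (rep : RepOracle X S A H T) (str : Strategy X S A H T) (Mobs : MDP X A H)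
    (t : Fin T) : Kernel (Unit × (Fin t → Round X S A H)) (Round X S A H) :=
  ((rep.estimate t).comap
      (fun q : Unit × (Fin t → Round X S A H) => fun i => ((q.2 i).1, (q.2 i).2.2))
      (by fun_prop)) ⊗ₖ
    (((str.dist t).comap
        (fun q : (Unit × (Fin t → Round X S A H)) × (MDP S A H × Decoder X S H) => (q.1.2, q.2))
        (by fun_prop)) ⊗ₖ
      ((trajKernel Mobs).comap
        (fun q : ((Unit × (Fin t → Round X S A H)) × (MDP S A H × Decoder X S H)) ×
          Policy X A H => q.2) measurable_snd))

instance {T : ℕ} (rep : RepOracle X S A H T) (str : Strategy X S A H T) (Mobs : MDP X A H)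
    (t : Fin T) : IsMarkovKernel (roundKernel rep str Mobs t) := by
  have := rep.isMarkov t
  have := str.isMarkov t
  unfold roundKernel; infer_instance

/-- The joint law of the `T` rounds of the online protocol. -/
def protocolLaw {T : ℕ} (rep : RepOracle X S A H T) (str : Strategy X S A H T)
    (Mobs : MDP X A H) : Measure (Fin T → Round X S A H) :=
  historyKernel (roundKernel rep str Mobs) T le_rfl ()

/-- The optimistic self-predictive regret
`∑_t (∑_h E_{π ∼ p_t} E^π [Δ_h(M_t, φ_t)(x_h, a_h)] + γ⁻¹ (J^Mstar(π_Mstar) - J^{M_t}(π_{M_t})))`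
along a realization of the online protocol. -/
def optSelfPredRegret {T : ℕ} (str : Strategy X S A H T) (Mstar : MDP S A H) (Mobs : MDP X A H)
    (γ : ℝ) (w : Fin T → Round X S A H) : ℝ :=
  ∑ t : Fin T,
    ((∫ π, expectedSelfPredErr Mobs (w t).1.1 (w t).1.2 π
        ∂(str.dist t (fun i : Fin t => w (Fin.castLE t.isLt.le i), (w t).1))) +
      γ⁻¹ * (optValue Mstar - optValue (w t).1.1))

/-- For every adaptive sequence of policies, the expected optimistic self-predictive regret of the
oracle is at most `est`. -/
def RegretBound {T : ℕ} (rep : RepOracle X S A H T) (Mstar : MDP S A H) (Mobs : MDP X A H)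
    (γ est : ℝ) : Prop :=
  ∀ str : Strategy X S A H T,
    ∫ w, optSelfPredRegret str Mstar Mobs γ w ∂(protocolLaw rep str Mobs) ≤ est

/-! ### The observable-to-latent reduction -/

/-- The record of one epoch: the estimate of the oracle, the `K + 1` latent policies and
trajectories of the epoch, and the index of the trajectory passed on to the oracle. -/
abbrev Epoch (X S A : Type*) [MeasurableSpace X] [MeasurableSpace S] [MeasurableSpace A]
    (H K : ℕ) :=
  (MDP S A H × Decoder X S H) × (Fin (K + 1) → Policy S A H × Traj X A H) × Fin (K + 1)

/-- What the oracle has seen: its previous estimates, and the trajectory selected from each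
previous epoch. -/
def oracleView {K n : ℕ} (w : Fin n → Epoch X S A H K) :
    Fin n → (MDP S A H × Decoder X S H) × Traj X A H :=
  fun i => ((w i).1, ((w i).2.1 (w i).2.2).2)

lemma measurable_oracleView {K n : ℕ} :
    Measurable (oracleView : (Fin n → Epoch X S A H K) → _) := by
  refine measurable_pi_lambda _ fun i => ?_
  have hi : Measurable (fun w : Fin n → Epoch X S A H K => w i) := measurable_pi_apply i
  have e : Measurable (fun q : (Fin (K + 1) → Policy S A H × Traj X A H) × Fin (K + 1) =>
      (q.1 q.2).2) :=
    measurable_from_prod_countable_left fun k => measurable_snd.comp (measurable_pi_apply k)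
  exact (measurable_fst.comp hi).prodMk (e.comp (measurable_snd.comp hi))

/-- The base algorithm runs in the compressed dynamics of a decoder, and the index of the trajectory
that the oracle will receive is drawn uniformly from the `K + 1` episodes. -/
def runAndSelect {K : ℕ} (alg : BaseAlg S A H K) (Mobs : MDP X A H) :
    Kernel (Decoder X S H) ((Fin (K + 1) → Policy S A H × Traj X A H) × Fin (K + 1)) :=
  runKernel alg Mobs ⊗ₖ Kernel.const _ (PMF.uniformOfFintype (Fin (K + 1))).toMeasure

instance {K : ℕ} (alg : BaseAlg S A H K) (Mobs : MDP X A H) :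
    IsMarkovKernel (runAndSelect alg Mobs) := by
  unfold runAndSelect; infer_instance

/-- Epoch `t` of the reduction: the oracle draws an estimate from what it has seen, and a new
instance of the base algorithm runs in the compressed dynamics of the estimated decoder. -/
def epochKernel {K T : ℕ} (rep : RepOracle X S A H T) (alg : BaseAlg S A H K) (Mobs : MDP X A H)
    (t : Fin T) : Kernel (Unit × (Fin t → Epoch X S A H K)) (Epoch X S A H K) :=
  ((rep.estimate t).comap (fun q : Unit × (Fin t → Epoch X S A H K) => oracleView q.2)
      (measurable_oracleView.comp measurable_snd)) ⊗ₖ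
    ((runAndSelect alg Mobs).comap
      (fun q : (Unit × (Fin t → Epoch X S A H K)) × (MDP S A H × Decoder X S H) => q.2.2)
      (measurable_snd.comp measurable_snd))

instance {K T : ℕ} (rep : RepOracle X S A H T) (alg : BaseAlg S A H K) (Mobs : MDP X A H)
    (t : Fin T) : IsMarkovKernel (epochKernel rep alg Mobs t) := by
  have := rep.isMarkov t
  unfold epochKernel; infer_instance

/-- The joint law of the `T` epochs of the reduction in the environment `Mobs`. -/
def o2lLaw {K T : ℕ} (rep : RepOracle X S A H T) (alg : BaseAlg S A H K) (Mobs : MDP X A H) :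
    Measure (Fin T → Epoch X S A H K) :=
  historyKernel (epochKernel rep alg Mobs) T le_rfl ()

/-- Risk of the output of the reduction, the uniform mixture of the `T` policies obtained by
composing the final latent policy of each epoch with the decoder of that epoch. -/
def o2lRisk {K T : ℕ} (Mobs : MDP X A H) (w : Fin T → Epoch X S A H K) : ℝ :=
  optValue Mobs -
    (T : ℝ)⁻¹ * ∑ t, value Mobs (Policy.comp ((w t).2.1 (Fin.last K)).1 (w t).1.2)

/-- Expected risk of the reduction after `T` epochs of `K` episodes. -/
def o2lExpectedRisk {K T : ℕ} (rep : RepOracle X S A H T) (alg : BaseAlg S A H K)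
    (Mobs : MDP X A H) : ℝ :=
  ∫ w, o2lRisk Mobs w ∂(o2lLaw rep alg Mobs)

end Discrete

end LatentRL

end

open LatentRL

/-!
The risk of an epoch with estimate `(M, φ)` splits into the optimism gap `J_⋆(M_lat^⋆) - J_⋆(M)`,
the risk of the base algorithm in the `φ`-compressed dynamics measured in the model `M`, and the
difference between the values of the final policy in `M` and in the environment. The last two terms
are simulation errors: laws generated in the environment are compared with laws generated in `M`.

The comparison has to be subadditive in the squared Hellinger distance, with all errors measured
under the law of the environment: the total squared error of `K` episodes is then of order `K`
times the self-predictive error, where adding total variation distances would give `K ^ 2`. Mean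
values `u`, `v` in `[0, 1]` of a function under the two laws are compared by the Hellinger distance
`d = bernHell u v` of Bernoulli laws. In one step, `d` of the means exceeds the mean of `d` by the
squared Hellinger distance `δ` of the step plus a fluctuation of order `√(δ Var d)`. The convex
potential `hellPot = d + d ^ 2 / 4` gains a multiple of `Var d` under averaging, which absorbs the
fluctuation at the cost of a multiple of `δ` (`hellPot_integral_le`). This one-step inequality,
packaged as `HellingerControlled`, composes along trajectories and along runs of the base algorithm
(`hellingerControlled_traj`, `hellingerControlled_run`), and with AM-GM it gives `epoch_risk_le`.

Summed over epochs, the self-predictive errors and the optimism gaps form the regret of the oracle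
against the strategy that plays the policy of a uniformly chosen episode, since the reduction has
the law of that protocol (`protocolLaw_eq_map_o2lLaw`). Hence the risk is at most
`Risk_base + γ Est / T + O(K / γ)` (`o2lExpectedRisk_le_regret`). The factor `K` in front of `Est` in the theorem
is harmless even when `Est` is negative: `Est` also bounds the regret against the strategy that
plays a nearly optimal policy of each estimated model, and there an over-optimistic model is found
out by its self-predictive error, so that `Est ≥ - O(T / γ ^ 2)` (`neg_le_of_regretBound`).

Two facts about values are needed besides: the observable MDP has no larger optimal value than the
latent one, by averaging policies over emissions (`optValue_latentDynamics_le`), and the optimal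
value and a nearly optimal policy depend measurably on the model, because one countable family of
policies is optimal in the supremum for all models (`exists_seq_policy_optValue_eq_iSup`).
-/

namespace LatentRL

set_option linter.unusedSectionVars false

/-! ### Bounded measurable functions -/

/-- A real function that is measurable and bounded, hence integrable for every finite measure. -/
structure BddMeas {Ω : Type*} [MeasurableSpace Ω] (f : Ω → ℝ) : Prop where
  meas : Measurable f
  bdd : ∃ C, ∀ ω, |f ω| ≤ C

namespace BddMeas

variable {Ω Ω' : Type*} [MeasurableSpace Ω] [MeasurableSpace Ω'] {f g : Ω → ℝ}

lemma of_Icc {a b : ℝ} (hf : Measurable f) (h : ∀ ω, f ω ∈ Set.Icc a b) : BddMeas f :=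
  ⟨hf, max |a| |b|, fun ω => abs_le_max_abs_abs (h ω).1 (h ω).2⟩

lemma const (c : ℝ) : BddMeas (fun _ : Ω => c) := ⟨measurable_const, |c|, fun _ => le_rfl⟩

lemma add (hf : BddMeas f) (hg : BddMeas g) : BddMeas (fun ω => f ω + g ω) := by
  obtain ⟨C, hC⟩ := hf.bdd
  obtain ⟨D, hD⟩ := hg.bdd
  exact ⟨hf.meas.add hg.meas, C + D, fun ω => (abs_add_le _ _).trans (add_le_add (hC ω) (hD ω))⟩

lemma mul (hf : BddMeas f) (hg : BddMeas g) : BddMeas (fun ω => f ω * g ω) := by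
  obtain ⟨C, hC⟩ := hf.bdd
  obtain ⟨D, hD⟩ := hg.bdd
  refine ⟨hf.meas.mul hg.meas, C * D, fun ω => ?_⟩
  rw [abs_mul]
  exact mul_le_mul (hC ω) (hD ω) (abs_nonneg _) ((abs_nonneg _).trans (hC ω))

lemma const_mul (c : ℝ) (hf : BddMeas f) : BddMeas (fun ω => c * f ω) := (const c).mul hf

lemma neg (hf : BddMeas f) : BddMeas (fun ω => - f ω) := by
  simpa using hf.const_mul (-1)

lemma sub (hf : BddMeas f) (hg : BddMeas g) : BddMeas (fun ω => f ω - g ω) := by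
  simpa [sub_eq_add_neg] using hf.add hg.neg

lemma sum {ι : Type*} (s : Finset ι) {F : ι → Ω → ℝ} (h : ∀ i ∈ s, BddMeas (F i)) :
    BddMeas (fun ω => ∑ i ∈ s, F i ω) := by
  classical
  induction s using Finset.induction_on with
  | empty => simpa using const (0 : ℝ)
  | insert i s hi ih =>
    simp only [Finset.sum_insert hi]
    exact (h i (Finset.mem_insert_self _ _)).add
      (ih fun j hj => h j (Finset.mem_insert_of_mem hj))

lemma comp (hf : BddMeas f) {φ : Ω' → Ω} (hφ : Measurable φ) : BddMeas (fun ω => f (φ ω)) :=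
  ⟨hf.meas.comp hφ, hf.bdd.imp fun _ h ω => h (φ ω)⟩

lemma integrable (hf : BddMeas f) (μ : Measure Ω) [IsFiniteMeasure μ] : Integrable f μ := by
  obtain ⟨C, hC⟩ := hf.bdd
  exact Integrable.of_bound hf.meas.aestronglyMeasurable C (Filter.Eventually.of_forall hC)

lemma integral_kernel {F : Ω × Ω' → ℝ} (hF : BddMeas F) (κ : Kernel Ω Ω') [IsMarkovKernel κ] :
    BddMeas (fun ω => ∫ y, F (ω, y) ∂(κ ω)) := by
  obtain ⟨C, hC⟩ := hF.bdd
  refine ⟨(StronglyMeasurable.integral_kernel_prod_right (f := fun ω y => F (ω, y)) (κ := κ)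
    hF.meas.stronglyMeasurable).measurable, C, fun ω => ?_⟩
  have := norm_integral_le_of_norm_le_const (μ := κ ω) (f := fun y => F (ω, y)) (C := C)
    (Filter.Eventually.of_forall fun y => hC (ω, y))
  simpa using this

lemma integral_kernel' {F : Ω' → ℝ} (hF : BddMeas F) (κ : Kernel Ω Ω') [IsMarkovKernel κ] :
    BddMeas (fun ω => ∫ y, F y ∂(κ ω)) :=
  (hF.comp (measurable_snd (α := Ω))).integral_kernel κ

end BddMeas

lemma integral_mem_Icc {Ω : Type*} [MeasurableSpace Ω] {P : Measure Ω} [IsProbabilityMeasure P]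
    {f : Ω → ℝ} {a b : ℝ} (hf : Measurable f) (h : ∀ ω, f ω ∈ Set.Icc a b) :
    ∫ ω, f ω ∂P ∈ Set.Icc a b := by
  have hi := (BddMeas.of_Icc hf h).integrable P
  constructor
  · simpa using integral_mono (μ := P) (integrable_const a) hi fun ω => (h ω).1
  · simpa using integral_mono (μ := P) hi (integrable_const b) fun ω => (h ω).2

/-! ### The Bernoulli Hellinger distance and its convex potential -/

/-- Squared Hellinger distance between Bernoulli laws of parameters `u` and `v`. -/
noncomputable def bernHell (u v : ℝ) : ℝ := 2 - 2 * (√(u * v) + √((1 - u) * (1 - v)))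

/-- A convex increasing function of `bernHell u v`. The quadratic term pays for the fluctuations of
the Hellinger distance along a process, so that the total error is measured under one of the two
laws only. -/
noncomputable def hellPot (u v : ℝ) : ℝ := bernHell u v + bernHell u v ^ 2 / 4

lemma sqrt_mul_add_sqrt_mul_le_one {u v : ℝ} (hu : u ∈ Set.Icc (0 : ℝ) 1)
    (hv : v ∈ Set.Icc (0 : ℝ) 1) : √(u * v) + √((1 - u) * (1 - v)) ≤ 1 := by
  obtain ⟨h0, h1⟩ := hu
  obtain ⟨k0, k1⟩ := hv
  have a : √(u * v) ≤ (u + v) / 2 :=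
    Real.sqrt_le_iff.2 ⟨by linarith, by nlinarith [sq_nonneg (u - v)]⟩
  have b : √((1 - u) * (1 - v)) ≤ ((1 - u) + (1 - v)) / 2 :=
    Real.sqrt_le_iff.2 ⟨by linarith, by nlinarith [sq_nonneg (u - v)]⟩
  linarith

lemma bernHell_mem {u v : ℝ} (hu : u ∈ Set.Icc (0 : ℝ) 1) (hv : v ∈ Set.Icc (0 : ℝ) 1) :
    bernHell u v ∈ Set.Icc (0 : ℝ) 2 := by
  have := sqrt_mul_add_sqrt_mul_le_one hu hv
  have h1 := Real.sqrt_nonneg (u * v)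
  have h2 := Real.sqrt_nonneg ((1 - u) * (1 - v))
  unfold bernHell
  constructor <;> linarith

lemma bernHell_self {u : ℝ} (hu : u ∈ Set.Icc (0 : ℝ) 1) : bernHell u u = 0 := by
  unfold bernHell
  rw [Real.sqrt_mul_self hu.1, Real.sqrt_mul_self (by linarith [hu.2])]
  ring

lemma hellPot_self {u : ℝ} (hu : u ∈ Set.Icc (0 : ℝ) 1) : hellPot u u = 0 := by
  simp [hellPot, bernHell_self hu]

lemma bernHell_le_hellPot (u v : ℝ) : bernHell u v ≤ hellPot u v := by
  unfold hellPot; nlinarith [sq_nonneg (bernHell u v)]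

lemma sq_sub_le_bernHell {u v : ℝ} (hu : u ∈ Set.Icc (0 : ℝ) 1) (hv : v ∈ Set.Icc (0 : ℝ) 1) :
    (u - v) ^ 2 ≤ bernHell u v := by
  have hc := sqrt_mul_add_sqrt_mul_le_one hu hv
  obtain ⟨h0, h1⟩ := hu
  obtain ⟨k0, k1⟩ := hv
  have h1' : 0 ≤ 1 - u := by linarith
  have k1' : 0 ≤ 1 - v := by linarith
  have hd : bernHell u v = 2 - 2 * (√(u * v) + √((1 - u) * (1 - v))) := rfl
  rw [Real.sqrt_mul h0, Real.sqrt_mul h1'] at hc hd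
  obtain ⟨a, ha⟩ : ∃ a, a = √u := ⟨_, rfl⟩
  obtain ⟨b, hb⟩ : ∃ b, b = √v := ⟨_, rfl⟩
  obtain ⟨a', ha'⟩ : ∃ a, a = √(1 - u) := ⟨_, rfl⟩
  obtain ⟨b', hb'⟩ : ∃ b, b = √(1 - v) := ⟨_, rfl⟩
  have eu : a ^ 2 = u := by rw [ha, Real.sq_sqrt h0]
  have ev : b ^ 2 = v := by rw [hb, Real.sq_sqrt k0]
  have eu' : a' ^ 2 = 1 - u := by rw [ha', Real.sq_sqrt h1']
  have ev' : b' ^ 2 = 1 - v := by rw [hb', Real.sq_sqrt k1']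
  rw [← ha, ← hb, ← ha', ← hb'] at hc hd
  have nn : 0 ≤ a * b + a' * b' := by
    rw [ha, hb, ha', hb']; positivity
  have na : a ^ 2 + a' ^ 2 = 1 := by linarith
  have nb : b ^ 2 + b' ^ 2 = 1 := by linarith
  -- With `c = a b + a' b'`, the cosine of the angle between the unit vectors `(a, a')` and
  -- `(b, b')`, the difference `u - v` is the product of two numbers, one of square `1 - c²`.
  have e1 : u - v = (a * b' - b * a') * (a * b' + b * a') := by
    have : u - v = a ^ 2 * (b ^ 2 + b' ^ 2) - b ^ 2 * (a ^ 2 + a' ^ 2) := by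
      rw [na, nb, eu, ev]; ring
    rw [this]; ring
  have e2 : (a * b' - b * a') ^ 2 = 1 - (a * b + a' * b') ^ 2 := by
    have : (1 : ℝ) = (a ^ 2 + a' ^ 2) * (b ^ 2 + b' ^ 2) := by rw [na, nb]; ring
    rw [this]; ring
  have e3 : (a * b' + b * a') ^ 2 ≤ 1 := by
    have : (1 : ℝ) = (a ^ 2 + a' ^ 2) * (b ^ 2 + b' ^ 2) := by rw [na, nb]; ring
    rw [this]; nlinarith [sq_nonneg (a * b - a' * b')]
  rw [hd, e1, mul_pow, e2]
  have e4 : 0 ≤ 1 - (a * b + a' * b') ^ 2 := by rw [← e2]; positivity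
  nlinarith

lemma measurable_bernHell : Measurable (fun q : ℝ × ℝ => bernHell q.1 q.2) := by
  unfold bernHell; fun_prop

lemma measurable_hellPot : Measurable (fun q : ℝ × ℝ => hellPot q.1 q.2) := by
  unfold hellPot
  exact measurable_bernHell.add ((measurable_bernHell.pow_const 2).div_const 4)

lemma hellPot_mem {u v : ℝ} (hu : u ∈ Set.Icc (0 : ℝ) 1) (hv : v ∈ Set.Icc (0 : ℝ) 1) :
    hellPot u v ∈ Set.Icc (0 : ℝ) 3 := by
  obtain ⟨h0, h1⟩ := bernHell_mem hu hv
  unfold hellPot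
  constructor <;> nlinarith

lemma bddMeas_hellPot {Ω : Type*} [MeasurableSpace Ω] {u v : Ω → ℝ} (hu : Measurable u)
    (hv : Measurable v) (hu' : ∀ ω, u ω ∈ Set.Icc (0 : ℝ) 1) (hv' : ∀ ω, v ω ∈ Set.Icc (0 : ℝ) 1) :
    BddMeas (fun ω => hellPot (u ω) (v ω)) :=
  .of_Icc (measurable_hellPot.comp (hu.prodMk hv)) fun ω => hellPot_mem (hu' ω) (hv' ω)

/-! ### One step of the Hellinger comparison -/

lemma integral_affine {Ω : Type*} [MeasurableSpace Ω] {P : Measure Ω} [IsProbabilityMeasure P]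
    {f g h k : Ω → ℝ} (hf : Integrable f P) (hg : Integrable g P) (hh : Integrable h P)
    (hk : Integrable k P) (a b c d z : ℝ) :
    ∫ ω, (a * f ω + (b * g ω + (c * h ω + (d * k ω + z)))) ∂P =
      a * ∫ ω, f ω ∂P + (b * ∫ ω, g ω ∂P + (c * ∫ ω, h ω ∂P + (d * ∫ ω, k ω ∂P + z))) := by
  have i1 : Integrable (fun ω => d * k ω + z) P := (hk.const_mul d).add (integrable_const z)
  have i2 : Integrable (fun ω => c * h ω + (d * k ω + z)) P := (hh.const_mul c).add i1
  have i3 : Integrable (fun ω => b * g ω + (c * h ω + (d * k ω + z))) P := (hg.const_mul b).add i2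
  rw [integral_add (hf.const_mul a) i3, integral_add (hg.const_mul b) i2,
    integral_add (hh.const_mul c) i1, integral_add (hk.const_mul d) (integrable_const z)]
  simp [integral_const_mul]

/-- Cauchy–Schwarz for `√f` and `ρ √g`. -/
lemma integral_mul_sqrt_mul_le {Ω : Type*} [MeasurableSpace Ω] {P : Measure Ω}
    {ρ f g : Ω → ℝ} (hρ : ∀ ω, 0 ≤ ρ ω) (hf : ∀ ω, 0 ≤ f ω) (hg : ∀ ω, 0 ≤ g ω)
    (mρ : Measurable ρ) (mf : Measurable f) (mg : Measurable g)
    (hfi : Integrable f P) (hgi : Integrable (fun ω => ρ ω ^ 2 * g ω) P) {U V : ℝ}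
    (hU : ∫ ω, f ω ∂P ≤ U) (hV : ∫ ω, ρ ω ^ 2 * g ω ∂P ≤ V) :
    ∫ ω, ρ ω * √(f ω * g ω) ∂P ≤ √(U * V) := by
  have hU0 : 0 ≤ U := (integral_nonneg hf).trans hU
  have key := integral_mul_le_Lp_mul_Lq_of_nonneg (μ := P) (p := 2) (q := 2)
    (by exact ⟨by norm_num, by norm_num, by norm_num⟩) (f := fun ω => √(f ω))
    (g := fun ω => ρ ω * √(g ω))
    (Filter.Eventually.of_forall fun ω => Real.sqrt_nonneg _)
    (Filter.Eventually.of_forall fun ω => mul_nonneg (hρ ω) (Real.sqrt_nonneg _))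
    (by
      rw [show ENNReal.ofReal 2 = 2 by norm_num]
      refine (memLp_two_iff_integrable_sq (by fun_prop)).2 ?_
      simpa only [Real.sq_sqrt (hf _)] using hfi)
    (by
      rw [show ENNReal.ofReal 2 = 2 by norm_num]
      refine (memLp_two_iff_integrable_sq (by fun_prop)).2 ?_
      simpa only [mul_pow, Real.sq_sqrt (hg _)] using hgi)
  have e1 : ∀ ω, √(f ω) ^ (2 : ℝ) = f ω := fun ω => by
    rw [Real.rpow_two, Real.sq_sqrt (hf ω)]
  have e2 : ∀ ω, (ρ ω * √(g ω)) ^ (2 : ℝ) = ρ ω ^ 2 * g ω := fun ω => by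
    rw [Real.rpow_two, mul_pow, Real.sq_sqrt (hg ω)]
  simp only [e1, e2] at key
  rw [← Real.sqrt_eq_rpow, ← Real.sqrt_eq_rpow, ← Real.sqrt_mul (integral_nonneg hf)] at key
  refine le_trans (le_of_eq ?_) (key.trans (Real.sqrt_le_sqrt ?_))
  · congr 1; ext ω; rw [Real.sqrt_mul (hf ω)]; ring
  · exact mul_le_mul hU hV (integral_nonneg fun ω => mul_nonneg (sq_nonneg _) (hg ω)) hU0

/-- Comparison of a `P`-mean of `u` with a `Q`-mean `V` of `v`, where `ρ` stands for the square root
of the density of (a quotient of) `Q` with respect to `P` and `δ` for their squared Hellinger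
distance. -/
lemma hellPot_integral_le {Ω : Type*} [MeasurableSpace Ω] {P : Measure Ω} [IsProbabilityMeasure P]
    {ρ u v : Ω → ℝ} {V δ : ℝ} (hρ : ∀ ω, 0 ≤ ρ ω) (mρ : Measurable ρ)
    (iρ : Integrable (fun ω => ρ ω ^ 2) P)
    (mu : Measurable u) (mv : Measurable v) (hu : ∀ ω, u ω ∈ Set.Icc (0 : ℝ) 1)
    (hv : ∀ ω, v ω ∈ Set.Icc (0 : ℝ) 1)
    (hδ : 2 - 2 * ∫ ω, ρ ω ∂P ≤ δ)
    (hV : ∫ ω, ρ ω ^ 2 * v ω ∂P ≤ V) (hV' : ∫ ω, ρ ω ^ 2 * (1 - v ω) ∂P ≤ 1 - V) :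
    hellPot (∫ ω, u ω ∂P) V ≤ ∫ ω, hellPot (u ω) (v ω) ∂P + 6 * δ := by
  have bu := BddMeas.of_Icc mu hu
  have bv := BddMeas.of_Icc mv hv
  have hu1 : ∀ ω, 0 ≤ 1 - u ω := fun ω => by linarith [(hu ω).2]
  have hv1 : ∀ ω, 0 ≤ 1 - v ω := fun ω => by linarith [(hv ω).2]
  have iρv : Integrable (fun ω => ρ ω ^ 2 * v ω) P :=
    iρ.mul_bdd (c := 1) mv.aestronglyMeasurable (Filter.Eventually.of_forall fun ω => by
      rw [Real.norm_eq_abs, abs_of_nonneg (hv ω).1]; exact (hv ω).2)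
  have iρv' : Integrable (fun ω => ρ ω ^ 2 * (1 - v ω)) P :=
    iρ.mul_bdd (c := 1) (by fun_prop) (Filter.Eventually.of_forall fun ω => by
      rw [Real.norm_eq_abs, abs_of_nonneg (hv1 ω)]; linarith [(hv ω).1])
  have hU : ∫ ω, u ω ∂P ∈ Set.Icc (0 : ℝ) 1 := integral_mem_Icc mu hu
  have hV01 : V ∈ Set.Icc (0 : ℝ) 1 :=
    ⟨(integral_nonneg fun ω => mul_nonneg (sq_nonneg _) (hv ω).1).trans hV, by
      linarith [(integral_nonneg fun ω => mul_nonneg (sq_nonneg (ρ ω)) (hv1 ω) :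
        0 ≤ ∫ ω, ρ ω ^ 2 * (1 - v ω) ∂P)]⟩
  have iρ1 : Integrable ρ P := by
    have : MemLp ρ 2 P := (memLp_two_iff_integrable_sq mρ.aestronglyMeasurable).2 iρ
    exact this.integrable (by norm_num)
  have hρ2 : ∫ ω, ρ ω ^ 2 ∂P ≤ 1 := by
    have : ∫ ω, ρ ω ^ 2 ∂P = ∫ ω, ρ ω ^ 2 * v ω ∂P + ∫ ω, ρ ω ^ 2 * (1 - v ω) ∂P := by
      rw [← integral_add iρv iρv']; congr 1; ext ω; ring
    linarith
  set d : Ω → ℝ := fun ω => bernHell (u ω) (v ω) with hd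
  have bd : BddMeas d := .of_Icc (measurable_bernHell.comp (mu.prodMk mv))
    fun ω => bernHell_mem (hu ω) (hv ω)
  have d02 : ∀ ω, d ω ∈ Set.Icc (0 : ℝ) 2 := fun ω => bernHell_mem (hu ω) (hv ω)
  set m := ∫ ω, d ω ∂P with hm
  have hm02 : m ∈ Set.Icc (0 : ℝ) 2 := integral_mem_Icc bd.meas d02
  have id := bd.integrable P
  have id2 := (bd.mul bd).integrable P
  have iρd : Integrable (fun ω => ρ ω * d ω) P :=
    iρ1.mul_bdd (c := 2) bd.meas.aestronglyMeasurable (Filter.Eventually.of_forall fun ω => by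
      rw [Real.norm_eq_abs, abs_of_nonneg (d02 ω).1]; exact (d02 ω).2)
  set r := ∫ ω, ρ ω ∂P with hr
  set v2 := ∫ ω, d ω * d ω ∂P with hv2
  -- the affinity of the two Bernoulli means dominates the `ρ`-average of the affinities
  have hD : bernHell (∫ ω, u ω ∂P) V ≤ 2 - 2 * r + ∫ ω, ρ ω * d ω ∂P := by
    have c1 := integral_mul_sqrt_mul_le (P := P) hρ (fun ω => (hu ω).1) (fun ω => (hv ω).1) mρ mu mv
      (bu.integrable P) iρv le_rfl hV
    have c2 := integral_mul_sqrt_mul_le (P := P) (U := 1 - ∫ ω, u ω ∂P) hρ hu1 hv1 mρ (by fun_prop)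
      (by fun_prop) (((BddMeas.const 1).sub bu).integrable P) iρv'
      (by rw [integral_sub (integrable_const 1) (bu.integrable P)]; simp) hV'
    have bs : ∀ f g : Ω → ℝ, Measurable f → Measurable g → (∀ ω, f ω ∈ Set.Icc (0:ℝ) 1) →
        (∀ ω, g ω ∈ Set.Icc (0:ℝ) 1) → Integrable (fun ω => ρ ω * √(f ω * g ω)) P := by
      intro f g hf hg hf' hg'
      refine iρ1.mul_bdd (c := 1) (by fun_prop) (Filter.Eventually.of_forall fun ω => ?_)
      rw [Real.norm_eq_abs, abs_of_nonneg (Real.sqrt_nonneg _)]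
      exact Real.sqrt_le_one.2 (mul_le_one₀ (hf' ω).2 (hg' ω).1 (hg' ω).2)
    have i1 := bs u v mu mv hu hv
    have i2 := bs (fun ω => 1 - u ω) (fun ω => 1 - v ω) (by fun_prop) (by fun_prop)
      (fun ω => ⟨hu1 ω, by linarith [(hu ω).1]⟩) (fun ω => ⟨hv1 ω, by linarith [(hv ω).1]⟩)
    have e : ∫ ω, ρ ω * d ω ∂P = 2 * r - 2 * (∫ ω, ρ ω * √(u ω * v ω) ∂P +
        ∫ ω, ρ ω * √((1 - u ω) * (1 - v ω)) ∂P) := by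
      have := integral_affine iρ1 i1 i2 i1 2 (-2) (-2) 0 0
      refine Eq.trans ?_ (this.trans (by simp only [← hr]; ring))
      congr 1; ext ω; simp only [hd, bernHell]; ring
    rw [e]; unfold bernHell; linarith
  have hD02 := bernHell_mem hU hV01
  -- split `ρ d` into its mean part and a fluctuation, bounded by an AM-GM with weight `2`
  have hfl : ∫ ω, ρ ω * d ω ∂P ≤ r * m + 2 * (2 - 2 * r) + (v2 - m ^ 2) / 8 := by
    have hp : ∫ ω, ρ ω * d ω ∂P ≤ ∫ ω, ((m - 4) * ρ ω + (2 * ρ ω ^ 2 + ((1 - m / 4) * d ω +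
        (1 / 8 * (d ω * d ω) + (2 - m + m ^ 2 / 8))))) ∂P := by
      refine integral_mono iρd ?_ fun ω => ?_
      · exact (iρ1.const_mul _).add ((iρ.const_mul _).add ((id.const_mul _).add
          ((id2.const_mul _).add (integrable_const _))))
      have := sq_nonneg (4 * (ρ ω - 1) - (d ω - m))
      simp only
      nlinarith
    refine hp.trans ?_
    rw [integral_affine iρ1 iρ id id2]
    simp only [← hm, ← hr, ← hv2]
    nlinarith
  have hr1 : r ≤ 1 := by
    have : 0 ≤ ∫ ω, (ρ ω - 1) ^ 2 ∂P := integral_nonneg fun ω => sq_nonneg _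
    have e : ∫ ω, (ρ ω - 1) ^ 2 ∂P = ∫ ω, ρ ω ^ 2 ∂P - 2 * r + 1 := by
      refine Eq.trans ?_ ((integral_affine iρ iρ1 iρ1 iρ1 1 (-2) 0 0 1).trans (by rw [← hr]; ring))
      congr 1; ext ω; ring
    linarith
  have hvar : 0 ≤ v2 - m ^ 2 := by
    have : 0 ≤ ∫ ω, (d ω - m) ^ 2 ∂P := integral_nonneg fun ω => sq_nonneg _
    have e : ∫ ω, (d ω - m) ^ 2 ∂P = v2 - 2 * m * m + m ^ 2 := by
      refine Eq.trans ?_ ((integral_affine id2 id id id 1 (-2 * m) 0 0 (m ^ 2)).trans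
        (by rw [← hm]; ring))
      congr 1; ext ω; ring
    nlinarith
  have hg : ∫ ω, hellPot (u ω) (v ω) ∂P = m + v2 / 4 := by
    have : (fun ω => hellPot (u ω) (v ω)) = fun ω => d ω + (d ω * d ω) / 4 := by
      ext ω; simp only [hellPot, hd]; ring
    rw [this, integral_add id (id2.div_const 4), integral_div]
  rw [hg]
  unfold hellPot
  set D := bernHell (∫ ω, u ω ∂P) V
  have hx : D ≤ m + (3 * δ + (v2 - m ^ 2) / 8) := by
    have : r * m ≤ m := by nlinarith [hm02.1]
    linarith
  have hx0 : 0 ≤ 3 * δ + (v2 - m ^ 2) / 8 := by linarith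
  have hfac : D + D ^ 2 / 4 - (m + m ^ 2 / 4) = (D - m) * (1 + (D + m) / 4) := by ring
  have : (D - m) * (1 + (D + m) / 4) ≤ 2 * (3 * δ + (v2 - m ^ 2) / 8) := by
    rcases le_total D m with h | h
    · nlinarith [hD02.1, hm02.1]
    · nlinarith [hD02.1, hm02.1, hD02.2, hm02.2]
  linarith

/-! ### Squared Hellinger distance of measures -/

section Hellinger

variable {Ω : Type*} [MeasurableSpace Ω]

lemma hellingerSq_nonneg (p q : Measure Ω) : 0 ≤ hellingerSq p q :=
  integral_nonneg fun _ => sq_nonneg _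

lemma integrable_sqrt_mul_sqrt_rnDeriv (p q : Measure Ω) [IsFiniteMeasure p] [IsFiniteMeasure q] :
    Integrable (fun ω => √(p.rnDeriv (p + q) ω).toReal * √(q.rnDeriv (p + q) ω).toReal)
      (p + q) := by
  refine ((Measure.integrable_toReal_rnDeriv (μ := p) (ν := p + q)).add
    (Measure.integrable_toReal_rnDeriv (μ := q) (ν := p + q))).mono' ?_
    (Filter.Eventually.of_forall fun ω => ?_)
  · exact ((Measure.measurable_rnDeriv _ _).ennreal_toReal.sqrt.mul
      (Measure.measurable_rnDeriv _ _).ennreal_toReal.sqrt).aestronglyMeasurable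
  · rw [Real.norm_eq_abs, abs_of_nonneg (by positivity)]
    have h1 := Real.sq_sqrt (ENNReal.toReal_nonneg (a := p.rnDeriv (p + q) ω))
    have h2 := Real.sq_sqrt (ENNReal.toReal_nonneg (a := q.rnDeriv (p + q) ω))
    simp only [Pi.add_apply]
    nlinarith [sq_nonneg (√(p.rnDeriv (p + q) ω).toReal - √(q.rnDeriv (p + q) ω).toReal),
      Real.sqrt_nonneg (p.rnDeriv (p + q) ω).toReal, Real.sqrt_nonneg (q.rnDeriv (p + q) ω).toReal]

lemma hellingerSq_eq (p q : Measure Ω) [IsProbabilityMeasure p] [IsProbabilityMeasure q] :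
    hellingerSq p q =
      2 - 2 * ∫ ω, √(p.rnDeriv (p + q) ω).toReal * √(q.rnDeriv (p + q) ω).toReal ∂(p + q) := by
  have hp : p ≪ p + q := Measure.AbsolutelyContinuous.rfl.add_right _
  have hq : q ≪ p + q := by rw [add_comm]; exact Measure.AbsolutelyContinuous.rfl.add_right _
  have ip := Measure.integrable_toReal_rnDeriv (μ := p) (ν := p + q)
  have iq := Measure.integrable_toReal_rnDeriv (μ := q) (ν := p + q)
  have ep : ∫ ω, (p.rnDeriv (p + q) ω).toReal ∂(p + q) = 1 := by
    rw [Measure.integral_toReal_rnDeriv hp]; simp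
  have eq' : ∫ ω, (q.rnDeriv (p + q) ω).toReal ∂(p + q) = 1 := by
    rw [Measure.integral_toReal_rnDeriv hq]; simp
  have ipq := integrable_sqrt_mul_sqrt_rnDeriv p q
  unfold hellingerSq
  have e : ∀ ω, (√(p.rnDeriv (p + q) ω).toReal - √(q.rnDeriv (p + q) ω).toReal) ^ 2 =
      ((p.rnDeriv (p + q) ω).toReal + (q.rnDeriv (p + q) ω).toReal) -
        2 * (√(p.rnDeriv (p + q) ω).toReal * √(q.rnDeriv (p + q) ω).toReal) := fun ω => by
    rw [sub_sq, Real.sq_sqrt ENNReal.toReal_nonneg, Real.sq_sqrt ENNReal.toReal_nonneg]; ring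
  simp only [e]
  have ipaq : Integrable (fun ω => (p.rnDeriv (p + q) ω).toReal + (q.rnDeriv (p + q) ω).toReal)
      (p + q) := ip.add iq
  rw [integral_sub ipaq (ipq.const_mul 2), integral_add ip iq, ep, eq', integral_const_mul]
  ring

lemma hellingerSq_le_two (p q : Measure Ω) [IsProbabilityMeasure p] [IsProbabilityMeasure q] :
    hellingerSq p q ≤ 2 := by
  rw [hellingerSq_eq]
  have : 0 ≤ ∫ ω, √(p.rnDeriv (p + q) ω).toReal * √(q.rnDeriv (p + q) ω).toReal ∂(p + q) :=
    integral_nonneg fun ω => by positivity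
  linarith

/-- The square root `ρ` of the density of the absolutely continuous part of `q` with respect to
`p`: its `p`-mean is the Hellinger affinity. -/
lemma exists_sqrt_density (p q : Measure Ω) [IsProbabilityMeasure p] [IsProbabilityMeasure q] :
    ∃ ρ : Ω → ℝ, Measurable ρ ∧ (∀ ω, 0 ≤ ρ ω) ∧ Integrable (fun ω => ρ ω ^ 2) p ∧
      2 - 2 * ∫ ω, ρ ω ∂p = hellingerSq q p ∧
      ∀ w : Ω → ℝ, BddMeas w → (∀ ω, 0 ≤ w ω) → ∫ ω, ρ ω ^ 2 * w ω ∂p ≤ ∫ ω, w ω ∂q := by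
  have hp : p ≪ p + q := Measure.AbsolutelyContinuous.rfl.add_right _
  have hq : q ≪ p + q := by rw [add_comm]; exact Measure.AbsolutelyContinuous.rfl.add_right _
  set f : Ω → ℝ := fun ω => (p.rnDeriv (p + q) ω).toReal with hf
  set g : Ω → ℝ := fun ω => (q.rnDeriv (p + q) ω).toReal with hg
  have mf : Measurable f := (Measure.measurable_rnDeriv _ _).ennreal_toReal
  have mg : Measurable g := (Measure.measurable_rnDeriv _ _).ennreal_toReal
  have f0 : ∀ ω, 0 ≤ f ω := fun ω => ENNReal.toReal_nonneg
  have g0 : ∀ ω, 0 ≤ g ω := fun ω => ENNReal.toReal_nonneg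
  have ig : Integrable g (p + q) := Measure.integrable_toReal_rnDeriv
  have key : ∀ ω, f ω * (√(g ω) / √(f ω)) ^ 2 ≤ g ω := fun ω => by
    rw [div_pow, Real.sq_sqrt (g0 ω), Real.sq_sqrt (f0 ω)]
    rcases eq_or_ne (f ω) 0 with h | h
    · simpa [h] using g0 ω
    · rw [mul_div_cancel₀ _ h]
  refine ⟨fun ω => √(g ω) / √(f ω), mg.sqrt.div mf.sqrt, fun ω => by positivity, ?_, ?_, ?_⟩
  · rw [← integrable_rnDeriv_smul_iff hp]
    refine ig.mono' (by fun_prop) (Filter.Eventually.of_forall fun ω => ?_)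
    rw [smul_eq_mul, Real.norm_eq_abs, abs_of_nonneg (mul_nonneg (f0 ω) (sq_nonneg _))]
    exact key ω
  · rw [hellingerSq_eq, ← integral_rnDeriv_smul hp, add_comm q p]
    congr 3
    ext ω
    change f ω * (√(g ω) / √(f ω)) = √(g ω) * √(f ω)
    rcases eq_or_ne (f ω) 0 with h | h
    · simp [h]
    · have h' : √(f ω) ≠ 0 := Real.sqrt_ne_zero'.2 (lt_of_le_of_ne (f0 ω) h.symm)
      rw [mul_div_assoc', div_eq_iff h', mul_assoc, Real.mul_self_sqrt (f0 ω), mul_comm]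
  · intro w hw w0
    rw [← integral_rnDeriv_smul hp, ← integral_rnDeriv_smul hq]
    obtain ⟨C, hC⟩ := hw.bdd
    refine integral_mono_of_nonneg (Filter.Eventually.of_forall fun ω =>
      mul_nonneg (f0 ω) (mul_nonneg (sq_nonneg _) (w0 ω))) ?_
      (Filter.Eventually.of_forall fun ω => ?_)
    · exact ig.mul_bdd (c := C) hw.meas.aestronglyMeasurable (Filter.Eventually.of_forall hC)
    · simp only [smul_eq_mul]
      rw [← mul_assoc]
      exact mul_le_mul_of_nonneg_right (key ω) (w0 ω)

end Hellinger

/-! ### Hellinger comparison of two experiments -/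

section Coupled

variable {Ω Ω' Ω₁ Ω₁' Ω₂ Ω₂' : Type*} [MeasurableSpace Ω] [MeasurableSpace Ω']
  [MeasurableSpace Ω₁] [MeasurableSpace Ω₁'] [MeasurableSpace Ω₂] [MeasurableSpace Ω₂']

/-- `Q` is compared with `P` through the map `c`: for continuation values `u`, `v` in `[0, 1]`, the
potential of the mean values is at most the `P`-mean of the potential of the values plus the
`P`-mean of the error `e`. -/
def HellingerControlled (P : Measure Ω) (Q : Measure Ω') (c : Ω → Ω') (e : Ω → ℝ) : Prop :=
  ∀ (u : Ω → ℝ) (v : Ω' → ℝ), Measurable u → Measurable v → (∀ ω, u ω ∈ Set.Icc (0 : ℝ) 1) →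
    (∀ ω, v ω ∈ Set.Icc (0 : ℝ) 1) →
    hellPot (∫ ω, u ω ∂P) (∫ ω, v ω ∂Q) ≤ ∫ ω, (hellPot (u ω) (v (c ω)) + e ω) ∂P

/-- The comparison of one draw: the image of `P` under `c` against `Q`, at the cost of their
squared Hellinger distance. -/
lemma hellingerControlled_of_hellingerSq (P : Measure Ω) (Q : Measure Ω') [IsProbabilityMeasure P]
    [IsProbabilityMeasure Q] {c : Ω → Ω'} (hc : Measurable c) :
    HellingerControlled P Q c (fun _ => 6 * hellingerSq Q (P.map c)) := by
  intro u v mu mv hu hv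
  have := Measure.isProbabilityMeasure_map (μ := P) hc.aemeasurable
  obtain ⟨ρ, mρ, ρ0, iρ, hδ, hw⟩ := exists_sqrt_density (P.map c) Q
  have bv := BddMeas.of_Icc mv hv
  rw [integral_map hc.aemeasurable mρ.aestronglyMeasurable] at hδ
  have ipot : Integrable (fun ω => hellPot (u ω) (v (c ω))) P :=
    (bddMeas_hellPot mu (mv.comp hc) hu fun ω => hv _).integrable P
  rw [integral_add ipot (integrable_const _), integral_const, probReal_univ, one_smul]
  refine hellPot_integral_le (ρ := fun ω => ρ (c ω)) (fun ω => ρ0 _) (mρ.comp hc) ?_ mu (mv.comp hc)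
    hu (fun ω => hv _) hδ.le ?_ ?_
  · exact (integrable_map_measure (by fun_prop) hc.aemeasurable).1 iρ
  · have := hw v bv fun ω => (hv ω).1
    rwa [integral_map hc.aemeasurable (by fun_prop)] at this
  · have := hw (fun ω => 1 - v ω) ((BddMeas.const 1).sub bv) fun ω => by linarith [(hv ω).2]
    rw [integral_map hc.aemeasurable (by fun_prop), integral_sub (integrable_const 1)
      (bv.integrable Q)] at this
    simpa using this

lemma hellingerControlled_id (P : Measure Ω) [IsProbabilityMeasure P] :
    HellingerControlled P P id (fun _ => 0) := by
  intro u v mu mv hu hv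
  have bv := BddMeas.of_Icc mv hv
  have h := hellPot_integral_le (P := P) (ρ := fun _ => 1) (δ := 0) (V := ∫ ω, v ω ∂P)
    (fun _ => zero_le_one) measurable_const (integrable_const _) mu mv hu hv (by simp) (by simp)
    (by simp [integral_sub (integrable_const (1 : ℝ)) (bv.integrable P)])
  simpa using h

lemma HellingerControlled.map {P : Measure Ω} {Q : Measure Ω'} {c : Ω → Ω'}
    {c₁ : Ω₁ → Ω₁'} {e : Ω₁ → ℝ} {f : Ω → Ω₁} {f' : Ω' → Ω₁'}
    (h : HellingerControlled P Q c (fun ω => e (f ω))) (hf : Measurable f) (hf' : Measurable f')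
    (hc : ∀ ω, c₁ (f ω) = f' (c ω)) (mc : Measurable c₁) (me : Measurable e) :
    HellingerControlled (P.map f) (Q.map f') c₁ e := by
  intro u v mu mv hu hv
  rw [integral_map hf.aemeasurable mu.aestronglyMeasurable,
    integral_map hf'.aemeasurable mv.aestronglyMeasurable, integral_map hf.aemeasurable]
  · simp only [hc]
    exact h _ _ (mu.comp hf) (mv.comp hf') (fun _ => hu _) fun _ => hv _
  · exact ((measurable_hellPot.comp (mu.prodMk (mv.comp mc))).add me).aestronglyMeasurable

lemma HellingerControlled.congr_error {P : Measure Ω} {Q : Measure Ω'} {c : Ω → Ω'} {e e' : Ω → ℝ}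
    (h : HellingerControlled P Q c e) (he : ∀ ω, e ω = e' ω) : HellingerControlled P Q c e' := by
  rwa [show e' = e from (funext he).symm]

/-- Errors add up when experiments are performed one after the other. -/
lemma HellingerControlled.compProd {P : Measure Ω₁} {Q : Measure Ω₁'} [IsProbabilityMeasure P]
    [IsProbabilityMeasure Q] {κ : Kernel Ω₁ Ω₂} {κ' : Kernel Ω₁' Ω₂'} [IsMarkovKernel κ]
    [IsMarkovKernel κ'] {c₁ : Ω₁ → Ω₁'} {c₂ : Ω₂ → Ω₂'} {e₁ : Ω₁ → ℝ} {e₂ : Ω₁ × Ω₂ → ℝ}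
    (h₁ : HellingerControlled P Q c₁ e₁)
    (h₂ : ∀ ω, HellingerControlled (κ ω) (κ' (c₁ ω)) c₂ (fun y => e₂ (ω, y)))
    (hc₁ : Measurable c₁) (hc₂ : Measurable c₂) (he₁ : BddMeas e₁) (he₂ : BddMeas e₂) :
    HellingerControlled (P ⊗ₘ κ) (Q ⊗ₘ κ') (Prod.map c₁ c₂) (fun p => e₁ p.1 + e₂ p) := by
  intro u v mu mv hu hv
  have bu := BddMeas.of_Icc mu hu
  have bv := BddMeas.of_Icc mv hv
  have bp : BddMeas (fun p : Ω₁ × Ω₂ => hellPot (u p) (v (Prod.map c₁ c₂ p))) :=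
    bddMeas_hellPot mu (mv.comp (hc₁.prodMap hc₂)) hu fun _ => hv _
  have bt := bp.add ((he₁.comp measurable_fst).add he₂)
  rw [Measure.integral_compProd (bu.integrable _), Measure.integral_compProd (bv.integrable _),
    Measure.integral_compProd (bt.integrable _)]
  have bU := bu.integral_kernel κ
  have bV := bv.integral_kernel κ'
  have hU : ∀ ω, ∫ y, u (ω, y) ∂(κ ω) ∈ Set.Icc (0 : ℝ) 1 := fun ω =>
    integral_mem_Icc (mu.comp measurable_prodMk_left) fun y => hu _
  have hV : ∀ ω, ∫ y, v (ω, y) ∂(κ' ω) ∈ Set.Icc (0 : ℝ) 1 := fun ω =>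
    integral_mem_Icc (mv.comp measurable_prodMk_left) fun y => hv _
  refine (h₁ _ _ bU.meas bV.meas hU hV).trans (integral_mono ?_ ?_ fun ω => ?_)
  · exact ((bddMeas_hellPot bU.meas (bV.meas.comp hc₁) hU fun _ => hV _).add he₁).integrable P
  · exact (bt.integral_kernel κ).integrable P
  · have := h₂ ω (fun y => u (ω, y)) (fun y => v (c₁ ω, y)) (mu.comp measurable_prodMk_left)
      (mv.comp measurable_prodMk_left) (fun y => hu _) (fun y => hv _)
    simp only
    have b1 : BddMeas (fun y => hellPot (u (ω, y)) (v (c₁ ω, c₂ y)) + e₂ (ω, y)) :=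
      (bp.comp (measurable_prodMk_left (x := ω))).add (he₂.comp (measurable_prodMk_left (x := ω)))
    calc _ ≤ ∫ y, (hellPot (u (ω, y)) (v (c₁ ω, c₂ y)) + e₂ (ω, y)) ∂(κ ω) + e₁ ω := by gcongr
      _ = ∫ y, ((hellPot (u (ω, y)) (v (c₁ ω, c₂ y)) + e₂ (ω, y)) + e₁ ω) ∂(κ ω) := by
        rw [integral_add (b1.integrable _) (integrable_const _)]; simp
      _ = _ := by congr 1; ext y; simp only [Prod.map]; ring

/-- Errors add up along sequences generated one element at a time; `E n` is the error accumulated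
by the first `n` elements. -/
lemma HellingerControlled.history {Θ Θ' : Type*} [MeasurableSpace Θ] [MeasurableSpace Θ'] {N : ℕ}
    {κ : (n : Fin N) → Kernel (Θ × (Fin n → Ω)) Ω}
    {κ' : (n : Fin N) → Kernel (Θ' × (Fin n → Ω')) Ω'}
    (hκ : ∀ n, IsMarkovKernel (κ n)) (hκ' : ∀ n, IsMarkovKernel (κ' n))
    {c : Fin N → Ω → Ω'} (hc : ∀ n, Measurable (c n)) {θ : Θ} {θ' : Θ'}
    {E : (n : ℕ) → n ≤ N → (Fin n → Ω) → ℝ} (hE : ∀ n hn, BddMeas (E n hn))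
    (hE0 : ∀ w, E 0 (Nat.zero_le _) w = 0)
    (step : ∀ (n : Fin N) (w : Fin n → Ω),
      HellingerControlled (κ n (θ, w)) (κ' n (θ', fun i => c (Fin.castLE n.isLt.le i) (w i))) (c n)
        (fun ω => E (n + 1) n.isLt (Fin.snoc w ω) - E n n.isLt.le w)) :
    ∀ (n : ℕ) (hn : n ≤ N), HellingerControlled (historyKernel κ n hn θ) (historyKernel κ' n hn θ')
      (fun w i => c (Fin.castLE hn i) (w i)) (E n hn)
  | 0, _ => by
      intro u v mu mv hu hv
      have h0 : ∀ (w : Fin 0 → Ω) , w = fun i => i.elim0 := fun w => funext fun i => i.elim0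
      simp only [historyKernel, Kernel.const_apply]
      rw [integral_dirac' _ _ mu.stronglyMeasurable, integral_dirac' _ _ mv.stronglyMeasurable]
      have hfun : (fun w : Fin 0 → Ω => hellPot (u w) (v fun i => c (Fin.castLE (Nat.zero_le _) i)
          (w i)) + E 0 (Nat.zero_le _) w) = fun _ => hellPot (u fun i => i.elim0)
            (v fun i => i.elim0) := by
        ext w
        rw [hE0, add_zero, h0 w]
        congr 2
        ext i; exact i.elim0
      rw [hfun]
      simp
  | n + 1, hn => by
      have ih := HellingerControlled.history hκ hκ' hc hE hE0 step n (Nat.le_of_succ_le hn)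
      have := isMarkovKernel_historyKernel κ hκ n (Nat.le_of_succ_le hn)
      have := isMarkovKernel_historyKernel κ' hκ' n (Nat.le_of_succ_le hn)
      have := hκ ⟨n, hn⟩
      have := hκ' ⟨n, hn⟩
      have mc : ∀ (m : ℕ) (hm : m ≤ N),
          Measurable (fun (w : Fin m → Ω) i => c (Fin.castLE hm i) (w i)) :=
        fun m hm => measurable_pi_lambda _ fun i => (hc _).comp (measurable_pi_apply i)
      simp only [historyKernel]
      rw [Kernel.map_apply _ (measurable_snoc n), Kernel.map_apply _ (measurable_snoc n),
        Kernel.compProd_apply_eq_compProd_sectR, Kernel.compProd_apply_eq_compProd_sectR]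
      refine HellingerControlled.map
        (c := Prod.map (fun w i => c (Fin.castLE (Nat.le_of_succ_le hn) i) (w i)) (c ⟨n, hn⟩))
        ?_ (measurable_snoc n) (measurable_snoc n) ?_ (mc _ _) (hE _ _).meas
      · have bE : BddMeas (fun p : (Fin n → Ω) × Ω => E (n + 1) hn (Fin.snoc p.1 p.2) -
            E n (Nat.le_of_succ_le hn) p.1) :=
          ((hE _ _).comp (measurable_snoc n)).sub ((hE _ _).comp measurable_fst)
        refine (ih.compProd (e₂ := fun p => E (n + 1) hn (Fin.snoc p.1 p.2) -
            E n (Nat.le_of_succ_le hn) p.1) ?_ (mc _ _) (hc _) (hE _ _) bE).congr_error ?_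
        · intro w
          rw [Kernel.sectR_apply, Kernel.sectR_apply]
          exact step ⟨n, hn⟩ w
        · intro p; ring
      · intro p
        ext i
        refine Fin.lastCases ?_ (fun j => ?_) i
        · simp only [Fin.snoc_last]; rfl
        · simp only [Fin.snoc_castSucc]; rfl

end Coupled

/-! ### Integrals along sequences generated one element at a time -/

section History

variable {Θ Ω Ω' : Type*} [MeasurableSpace Θ] [MeasurableSpace Ω] [MeasurableSpace Ω'] {N : ℕ}

lemma measure_eq_of_forall_bddMeas {μ ν : Measure Ω} [IsProbabilityMeasure μ]
    [IsProbabilityMeasure ν] (h : ∀ f : Ω → ℝ, BddMeas f → ∫ ω, f ω ∂μ = ∫ ω, f ω ∂ν) : μ = ν := by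
  refine Measure.ext fun s hs => ?_
  have := h (s.indicator fun _ => 1) (.of_Icc (a := 0) (b := 1) (measurable_const.indicator hs)
    fun ω => by by_cases hω : ω ∈ s <;> simp [hω])
  simpa [integral_indicator hs, Measure.real, ENNReal.toReal_eq_toReal_iff'] using this

lemma integral_historyKernel_succ {κ : (n : Fin N) → Kernel (Θ × (Fin n → Ω)) Ω}
    (hκ : ∀ n, IsMarkovKernel (κ n)) (θ : Θ) (n : ℕ) (hn : n + 1 ≤ N)
    {F : (Fin (n + 1) → Ω) → ℝ} (hF : BddMeas F) :
    ∫ w, F w ∂(historyKernel κ (n + 1) hn θ) =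
      ∫ w, ∫ ω, F (Fin.snoc w ω) ∂(κ ⟨n, hn⟩ (θ, w))
        ∂(historyKernel κ n (Nat.le_of_succ_le hn) θ) := by
  have := isMarkovKernel_historyKernel κ hκ n (Nat.le_of_succ_le hn)
  have := hκ ⟨n, hn⟩
  simp only [historyKernel]
  rw [Kernel.map_apply _ (measurable_snoc n), Kernel.compProd_apply_eq_compProd_sectR,
    integral_map (measurable_snoc n).aemeasurable hF.meas.aestronglyMeasurable,
    Measure.integral_compProd ((hF.comp (measurable_snoc n)).integrable _)]
  rfl

/-- Functions of one element of a sequence are compared by comparing their conditional means. -/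
lemma integral_historyKernel_mono {κ : (n : Fin N) → Kernel (Θ × (Fin n → Ω)) Ω}
    (hκ : ∀ n, IsMarkovKernel (κ n)) (θ : Θ) {g g' : Ω → ℝ} (hg : BddMeas g) (hg' : BddMeas g')
    (i : Fin N) (h : ∀ w, ∫ ω, g ω ∂(κ i (θ, w)) ≤ ∫ ω, g' ω ∂(κ i (θ, w))) :
    ∀ (n : ℕ) (hn : n ≤ N) (hi : (i : ℕ) < n), ∫ w, g (w ⟨i, hi⟩) ∂(historyKernel κ n hn θ) ≤
      ∫ w, g' (w ⟨i, hi⟩) ∂(historyKernel κ n hn θ)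
  | 0, _, hi => absurd hi (Nat.not_lt_zero _)
  | n + 1, hn, hi => by
      have := isMarkovKernel_historyKernel κ hκ n (Nat.le_of_succ_le hn)
      have := hκ ⟨n, hn⟩
      rw [integral_historyKernel_succ hκ θ n hn (hg.comp (measurable_pi_apply _)),
        integral_historyKernel_succ hκ θ n hn (hg'.comp (measurable_pi_apply _))]
      rcases Nat.lt_succ_iff_lt_or_eq.1 hi with hlt | heq
      · have e : (⟨i, hi⟩ : Fin (n + 1)) = Fin.castSucc ⟨i, hlt⟩ := rfl
        simp only [e, Fin.snoc_castSucc, integral_const, probReal_univ, one_smul]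
        exact integral_historyKernel_mono hκ θ hg hg' i h n _ hlt
      · have e : (⟨i, hi⟩ : Fin (n + 1)) = Fin.last n := Fin.ext heq
        simp only [e, Fin.snoc_last]
        have hi' : i = ⟨n, hn⟩ := Fin.ext heq
        subst hi'
        have b : ∀ {f : Ω → ℝ}, BddMeas f → Integrable (fun w => ∫ ω, f ω ∂(κ ⟨n, hn⟩ (θ, w)))
            (historyKernel κ n (Nat.le_of_succ_le hn) θ) := fun hf =>
          ((hf.integral_kernel' (κ ⟨n, hn⟩)).comp measurable_prodMk_left).integrable _
        exact integral_mono (b hg) (b hg') h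

/-- If one step commutes with a map `f`, so do sequences. -/
lemma historyKernel_map {κ : (n : Fin N) → Kernel (Θ × (Fin n → Ω)) Ω}
    {κ' : (n : Fin N) → Kernel (Θ × (Fin n → Ω')) Ω'} (hκ : ∀ n, IsMarkovKernel (κ n))
    (hκ' : ∀ n, IsMarkovKernel (κ' n)) (θ : Θ) {f : Ω → Ω'} (hf : Measurable f)
    (h : ∀ n w, κ' n (θ, fun i => f (w i)) = (κ n (θ, w)).map f) :
    ∀ (n : ℕ) (hn : n ≤ N), historyKernel κ' n hn θ =
      (historyKernel κ n hn θ).map fun w i => f (w i)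
  | 0, _ => by
      have hm : Measurable fun (w : Fin 0 → Ω) i => f (w i) := by fun_prop
      simp only [historyKernel, Kernel.const_apply]
      rw [Measure.map_dirac' hm]
      congr 1
      ext i; exact i.elim0
  | n + 1, hn => by
      have ih := historyKernel_map hκ hκ' θ hf h n (Nat.le_of_succ_le hn)
      have hm : ∀ m, Measurable fun (w : Fin m → Ω) i => f (w i) := fun m => by fun_prop
      have i1 := isMarkovKernel_historyKernel κ hκ (n + 1) hn
      have i2 := isMarkovKernel_historyKernel κ' hκ' (n + 1) hn
      have := hκ' ⟨n, hn⟩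
      have := Measure.isProbabilityMeasure_map (μ := historyKernel κ (n + 1) hn θ)
        (hm (n + 1)).aemeasurable
      refine measure_eq_of_forall_bddMeas fun F hF => ?_
      rw [integral_map (hm _).aemeasurable hF.meas.aestronglyMeasurable,
        integral_historyKernel_succ hκ' θ n hn hF,
        integral_historyKernel_succ hκ θ n hn (hF.comp (hm _)), ih]
      have bF : BddMeas fun p : (Fin n → Ω') × Ω' => F (Fin.snoc p.1 p.2) :=
        hF.comp (measurable_snoc n)
      have bU : BddMeas fun w' : Fin n → Ω' => ∫ ω', F (Fin.snoc w' ω') ∂(κ' ⟨n, hn⟩ (θ, w')) := by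
        have := (bF.comp (φ := fun q : (Θ × (Fin n → Ω')) × Ω' => (q.1.2, q.2))
          (by fun_prop)).integral_kernel (κ' ⟨n, hn⟩)
        exact this.comp (measurable_prodMk_left (x := θ))
      rw [integral_map (hm _).aemeasurable bU.meas.aestronglyMeasurable]
      congr 1
      ext w
      rw [h ⟨n, hn⟩ w, integral_map hf.aemeasurable
        (bF.comp measurable_prodMk_left).meas.aestronglyMeasurable]
      congr 1
      ext ω
      congr 1
      ext i
      refine Fin.lastCases ?_ (fun j => ?_) i
      · simp only [Fin.snoc_last]
      · simp only [Fin.snoc_castSucc]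

end History

section Discrete

variable {X S A : Type*}
  [MeasurableSpace X] [DiscreteMeasurableSpace X] [Countable X]
  [MeasurableSpace S] [DiscreteMeasurableSpace S] [Countable S]
  [MeasurableSpace A] [DiscreteMeasurableSpace A] [Countable A]
  {H : ℕ} {K T : ℕ}

/-! ### Compressed trajectories against trajectories of the estimated model -/

instance (M : MDP X A H) (φ : Decoder X S H) (h : Fin H) (x : X) (a : A) :
    IsProbabilityMeasure (pushforwardModel M φ h x a) := by
  unfold pushforwardModel
  exact Measure.isProbabilityMeasure_map (by fun_prop)

lemma selfPredErr_mem (Mobs : MDP X A H) (M : MDP S A H) (φ : Decoder X S H) (h : Fin H) (x : X)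
    (a : A) : selfPredErr Mobs M φ h x a ∈ Set.Icc (0 : ℝ) 2 :=
  ⟨hellingerSq_nonneg _ _, hellingerSq_le_two _ _⟩

lemma selfPredErrInit_mem (Mobs : MDP X A H) (M : MDP S A H) (φ : Decoder X S H) :
    selfPredErrInit Mobs M φ ∈ Set.Icc (0 : ℝ) 2 := by
  have : IsProbabilityMeasure ((Mobs.init : Measure X).map (φ 0)) :=
    Measure.isProbabilityMeasure_map (by fun_prop)
  exact ⟨hellingerSq_nonneg _ _, hellingerSq_le_two _ _⟩

/-- The self-predictive error accumulated by a trajectory. -/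
noncomputable def trajErr (Mobs : MDP X A H) (M : MDP S A H) (φ : Decoder X S H)
    (τ : Traj X A H) : ℝ :=
  selfPredErrInit Mobs M φ +
    ∑ h : Fin H, selfPredErr Mobs M φ h (τ.state h.castSucc) (τ.2 h).1

/-- Compress one step through the decoder of the next state. -/
def compressStep (φ : Decoder X S H) (h : Fin H) (s : Step X A) : Step S A :=
  (s.1, s.2.1, φ h.succ s.2.2)

lemma measurable_compressStep (φ : Decoder X S H) (h : Fin H) :
    Measurable (compressStep φ h : Step X A → Step S A) := by
  unfold compressStep; fun_prop

lemma state_compressStep (φ : Decoder X S H) {n : ℕ} (hn : n ≤ H) (x : X) (w : Fin n → Step X A)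
    (i : Fin (n + 1)) :
    Traj.state (φ 0 x, fun i => compressStep φ (Fin.castLE hn i) (w i)) i =
      φ (Fin.castLE (Nat.succ_le_succ hn) i) (Traj.state (x, w) i) := by
  refine Fin.cases ?_ (fun j => ?_) i
  · rfl
  · rfl

lemma state_snoc {n : ℕ} (x : X) (w : Fin n → Step X A) (s : Step X A) (i : Fin (n + 1)) :
    Traj.state (x, (Fin.snoc w s : Fin (n + 1) → Step X A)) i.castSucc = Traj.state (x, w) i := by
  refine Fin.cases ?_ (fun j => ?_) i
  · rfl
  · simp [Traj.state]

lemma state_snoc_last {n : ℕ} (x : X) (w : Fin n → Step X A) (s : Step X A) :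
    Traj.state (x, (Fin.snoc w s : Fin (n + 1) → Step X A)) (Fin.last (n + 1)) = s.2.2 := by
  have : ((Fin.snoc w s : Fin (n + 1) → Step X A) (Fin.last n)) = s := Fin.snoc_last ..
  change ((Fin.snoc w s : Fin (n + 1) → Step X A) (Fin.last n)).2.2 = _
  rw [this]

lemma stepKernel_apply (M : MDP X A H) (h : Fin H) (π : Policy X A H) (x : X)
    (w : Fin h → Step X A) :
    stepKernel M h ((π, x), w) =
      (π h (Traj.state (x, w) (Fin.last h)) : Measure A) ⊗ₘ
        (outcomeKernel M h).sectR (π, Traj.state (x, w) (Fin.last h)) := by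
  rw [stepKernel, Kernel.comap_apply, Kernel.compProd_apply_eq_compProd_sectR]
  rfl

lemma outcomeKernel_apply (M : MDP X A H) (h : Fin H) (π : Policy X A H) (x : X) (a : A) :
    outcomeKernel M h ((π, x), a) = M.joint h x a := rfl

lemma bddMeas_selfPredErr (Mobs : MDP X A H) (M : MDP S A H) (φ : Decoder X S H) (h : Fin H) :
    BddMeas (fun q : X × A => selfPredErr Mobs M φ h q.1 q.2) :=
  .of_Icc .of_discrete fun _ => selfPredErr_mem ..

lemma hellingerControlled_step (Mobs : MDP X A H) (M : MDP S A H) (φ : Decoder X S H)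
    (π : Policy S A H) (h : Fin H) (x : X) (w : Fin h → Step X A) :
    HellingerControlled (stepKernel Mobs h ((π.comp φ, x), w))
      (stepKernel M h ((π, φ 0 x), fun i => compressStep φ (Fin.castLE h.isLt.le i) (w i)))
      (compressStep φ h)
      (fun s => 6 * selfPredErr Mobs M φ h (Traj.state (x, w) (Fin.last h)) s.1) := by
  rw [stepKernel_apply, stepKernel_apply, state_compressStep φ h.isLt.le]
  set y := Traj.state (x, w) (Fin.last (h : ℕ))
  have hA : ((π.comp φ) h y : Measure A) =
      (π h (φ (Fin.castLE (Nat.succ_le_succ h.isLt.le) (Fin.last h)) y) : Measure A) := rfl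
  rw [hA]
  refine ((hellingerControlled_id _).compProd
    (c₂ := fun q : unitInterval × X => (q.1, φ h.succ q.2))
    (e₂ := fun p => 6 * selfPredErr Mobs M φ h y p.1) ?_ measurable_id (by fun_prop)
    (BddMeas.const 0) ?_).congr_error fun p => by simp
  · intro a
    rw [Kernel.sectR_apply, Kernel.sectR_apply, outcomeKernel_apply, outcomeKernel_apply]
    exact hellingerControlled_of_hellingerSq _ _ (by fun_prop)
  · exact ((bddMeas_selfPredErr Mobs M φ h).comp (φ := fun p : A × unitInterval × X => (y, p.1))
      (by fun_prop)).const_mul 6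

lemma hellingerControlled_traj (Mobs : MDP X A H) (M : MDP S A H) (φ : Decoder X S H)
    (π : Policy S A H) :
    HellingerControlled (trajKernel Mobs (π.comp φ)) (trajKernel M π) (compress φ)
      (fun τ => 6 * trajErr Mobs M φ τ) := by
  have i1 := isMarkovKernel_historyKernel (stepKernel Mobs) (fun _ => inferInstance) H le_rfl
  have i2 := isMarkovKernel_historyKernel (stepKernel M) (fun _ => inferInstance) H le_rfl
  rw [trajKernel, trajKernel, Kernel.compProd_apply_eq_compProd_sectR,
    Kernel.compProd_apply_eq_compProd_sectR, Kernel.const_apply, Kernel.const_apply]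
  have bE : ∀ (n : ℕ) (hn : n ≤ H), BddMeas (fun τ : Traj X A n =>
      ∑ i : Fin n, 6 * selfPredErr Mobs M φ (Fin.castLE hn i) (τ.state i.castSucc) (τ.2 i).1) := by
    intro n hn
    refine BddMeas.sum _ fun i _ => ?_
    have hm : Measurable (fun τ : Traj X A n => (τ.state i.castSucc, (τ.2 i).1)) :=
      (Traj.measurable_state i.castSucc).prodMk
        (measurable_fst.comp ((measurable_pi_apply i).comp measurable_snd))
    exact ((bddMeas_selfPredErr Mobs M φ (Fin.castLE hn i)).comp hm).const_mul 6
  refine HellingerControlled.congr_error (HellingerControlled.compProd (c₁ := φ 0)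
    (c₂ := fun w i => compressStep φ i (w i))
    (e₂ := fun τ : Traj X A H =>
      ∑ i : Fin H, 6 * selfPredErr Mobs M φ i (τ.state i.castSucc) (τ.2 i).1)
    (hellingerControlled_of_hellingerSq _ _ (by fun_prop)) (fun x => ?_) (by fun_prop)
    (measurable_pi_lambda _ fun i => (measurable_compressStep φ i).comp (measurable_pi_apply i))
    (BddMeas.const _) (bE H le_rfl)) fun τ => ?_
  · rw [Kernel.sectR_apply, Kernel.sectR_apply]
    refine HellingerControlled.history (c := fun i => compressStep φ i)
      (E := fun n hn w => ∑ i : Fin n, 6 * selfPredErr Mobs M φ (Fin.castLE hn i)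
        (Traj.state (x, w) i.castSucc) (w i).1)
      (fun _ => inferInstance) (fun _ => inferInstance) (measurable_compressStep φ) (fun n hn => ?_)
      (fun w => by simp) (fun h w => ?_) H le_rfl
    · exact (bE n hn).comp (φ := fun w => (x, w)) measurable_prodMk_left
    · refine (hellingerControlled_step Mobs M φ π h x w).congr_error fun s => ?_
      rw [Fin.sum_univ_castSucc]
      simp only [state_snoc, Fin.snoc_castSucc, Fin.snoc_last]
      rw [add_comm, eq_sub_iff_add_eq]
      congr 1
  · rw [trajErr, mul_add, Finset.mul_sum]
    rfl

/-! ### A run of the base algorithm -/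

lemma bddMeas_trajErr (Mobs : MDP X A H) (M : MDP S A H) (φ : Decoder X S H) :
    BddMeas (trajErr Mobs M φ : Traj X A H → ℝ) := by
  refine (BddMeas.const _).add (BddMeas.sum _ fun h _ => ?_)
  have hm : Measurable (fun τ : Traj X A H => (τ.state h.castSucc, (τ.2 h).1)) :=
    (Traj.measurable_state h.castSucc).prodMk
      (measurable_fst.comp ((measurable_pi_apply h).comp measurable_snd))
  exact (bddMeas_selfPredErr Mobs M φ h).comp hm

lemma trajErr_nonneg (Mobs : MDP X A H) (M : MDP S A H) (φ : Decoder X S H) (τ : Traj X A H) :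
    0 ≤ trajErr Mobs M φ τ :=
  add_nonneg (selfPredErrInit_mem ..).1 (Finset.sum_nonneg fun _ _ => (selfPredErr_mem ..).1)

lemma integral_trajErr (Mobs : MDP X A H) (M : MDP S A H) (φ : Decoder X S H) (π : Policy X A H) :
    ∫ τ, trajErr Mobs M φ τ ∂(trajKernel Mobs π) = expectedSelfPredErr Mobs M φ π := by
  have hi : ∀ h : Fin H, Integrable (fun τ : Traj X A H =>
      selfPredErr Mobs M φ h (τ.state h.castSucc) (τ.2 h).1) (trajKernel Mobs π) := fun h => by
    have hm : Measurable (fun τ : Traj X A H => (τ.state h.castSucc, (τ.2 h).1)) :=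
      (Traj.measurable_state h.castSucc).prodMk
        (measurable_fst.comp ((measurable_pi_apply h).comp measurable_snd))
    exact ((bddMeas_selfPredErr Mobs M φ h).comp hm).integrable _
  unfold trajErr expectedSelfPredErr
  rw [integral_add (integrable_const _) (integrable_finsetSum _ fun h _ => hi h),
    integral_finsetSum _ fun h _ => hi h]
  simp

lemma expectedSelfPredErr_nonneg (Mobs : MDP X A H) (M : MDP S A H) (φ : Decoder X S H)
    (π : Policy X A H) : 0 ≤ expectedSelfPredErr Mobs M φ π := by
  rw [← integral_trajErr]
  exact integral_nonneg fun _ => trajErr_nonneg ..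

lemma episodeKernel_apply {K : ℕ} (alg : BaseAlg S A H K) (M : MDP X A H) (k : Fin (K + 1))
    (φ : Decoder X S H) (w : Fin k → Policy S A H × Traj X A H) [IsMarkovKernel (alg.policy k)] :
    episodeKernel alg M k (φ, w) = (alg.policy k (compressHistory φ w)) ⊗ₘ
      ((trajKernel M).comap (fun π => Policy.comp π φ)
        (measurable_policy_comp.comp measurable_prodMk_left)) := by
  rw [episodeKernel, Kernel.compProd_apply_eq_compProd_sectR]
  rfl

/-- The run of the base algorithm in the compressed dynamics of the environment, against its run in
the estimated model: the Hellinger errors of the episodes add up. -/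
lemma hellingerControlled_run {K : ℕ} (alg : BaseAlg S A H K) (Mobs : MDP X A H) (M : MDP S A H)
    (φ : Decoder X S H) :
    HellingerControlled (runKernel alg Mobs φ) (runKernel alg M (fun _ s => s))
      (compressHistory φ) (fun w => ∑ k, 6 * trajErr Mobs M φ (w k).2) := by
  have := alg.isMarkov
  unfold runKernel
  have mc : Measurable (fun p : Policy S A H × Traj X A H => (p.1, compress φ p.2)) :=
    measurable_fst.prodMk (measurable_compress.comp (measurable_const.prodMk measurable_snd))
  refine HellingerControlled.history (Ω := Policy S A H × Traj X A H)
    (c := fun _ p => (p.1, compress φ p.2))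
    (E := fun n _ w => ∑ i : Fin n, 6 * trajErr Mobs M φ (w i).2)
    (fun _ => inferInstance) (fun _ => inferInstance) (fun _ => mc) (fun n hn => ?_)
    (fun w => by simp) (fun k w => ?_) (K + 1) le_rfl
  · exact BddMeas.sum _ fun i _ => ((bddMeas_trajErr Mobs M φ).comp
      (measurable_snd.comp (measurable_pi_apply i))).const_mul 6
  · rw [episodeKernel_apply, episodeKernel_apply]
    have e1 : compressHistory (fun _ s => s) (fun i : Fin k => ((w i).1, compress φ (w i).2)) =
      compressHistory φ w := rfl
    rw [e1]
    refine ((hellingerControlled_id _).compProd (c₂ := compress φ)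
      (e₂ := fun p => 6 * trajErr Mobs M φ p.2) (fun π => ?_) measurable_id
      (measurable_compress.comp measurable_prodMk_left) (BddMeas.const 0)
      (((bddMeas_trajErr Mobs M φ).comp measurable_snd).const_mul 6)).congr_error fun p => ?_
    · rw [Kernel.comap_apply, Kernel.comap_apply]
      exact hellingerControlled_traj Mobs M φ π
    · rw [Fin.sum_univ_castSucc]
      simp

/-! ### Value functions -/

lemma integral_bind_probabilityMeasure (m : Measure S) [IsProbabilityMeasure m]
    (f : S → ProbabilityMeasure X) {g : X → ℝ} (hg : BddMeas g) :
    ∫ x, g x ∂(m.bind fun s => (f s : Measure X)) = ∫ s, ∫ x, g x ∂(f s : Measure X) ∂m := by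
  have hm : IsMarkovKernel (Kernel.ofFunOfCountable fun s => (f s : Measure X)) :=
    ⟨fun s => (f s).2⟩
  have h : m.bind (fun s => (f s : Measure X)) =
      (m ⊗ₘ Kernel.ofFunOfCountable fun s => (f s : Measure X)).map Prod.snd := by
    rw [← Measure.snd, Measure.snd_compProd]
    rfl
  rw [h, integral_map (by fun_prop) hg.meas.aestronglyMeasurable,
    Measure.integral_compProd ((hg.comp measurable_snd).integrable _)]
  rfl

/-- The Bellman backup: expected reward of `a` in `x` plus the expected value of the next state. -/
noncomputable def backup (M : MDP X A H) (h : Fin H) (W : X → ℝ) (x : X) (a : A) : ℝ :=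
  ∫ q, ((q.1 : ℝ) + W q.2) ∂(M.joint h x a)

/-- The value function of a policy: the expected sum of the remaining rewards. -/
noncomputable def valueFn (M : MDP X A H) (π : Policy X A H) (h : Fin (H + 1)) : X → ℝ :=
  Fin.reverseInduction (motive := fun _ => X → ℝ) (fun _ => 0)
    (fun h W x => ∫ a, backup M h W x a ∂(π h x : Measure A)) h

lemma valueFn_last (M : MDP X A H) (π : Policy X A H) (x : X) :
    valueFn M π (Fin.last H) x = 0 := by
  simp [valueFn]

lemma valueFn_castSucc (M : MDP X A H) (π : Policy X A H) (h : Fin H) (x : X) :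
    valueFn M π h.castSucc x = ∫ a, backup M h (valueFn M π h.succ) x a ∂(π h x : Measure A) := by
  rw [valueFn, Fin.reverseInduction_castSucc]
  rfl

lemma backup_mem {M : MDP X A H} {h : Fin H} {W : X → ℝ} {C : ℝ}
    (hW : ∀ x, W x ∈ Set.Icc 0 C) (x : X) (a : A) : backup M h W x a ∈ Set.Icc 0 (C + 1) := by
  refine integral_mem_Icc (by fun_prop) fun q => ?_
  have h1 := q.1.2
  have h2 := hW q.2
  exact ⟨add_nonneg h1.1 h2.1, by linarith [h1.2, h2.2]⟩

lemma valueFn_mem (M : MDP X A H) (π : Policy X A H) (h : Fin (H + 1)) :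
    ∀ x, valueFn M π h x ∈ Set.Icc (0 : ℝ) (H - h) := by
  induction h using Fin.reverseInduction with
  | last => intro x; rw [valueFn_last]; simp
  | cast h ih =>
    intro x
    rw [valueFn_castSucc]
    refine integral_mem_Icc .of_discrete fun a => ?_
    have := backup_mem (M := M) (h := h) ih x a
    simp only [Fin.val_succ, Nat.cast_add, Nat.cast_one, Fin.val_castSucc] at this ⊢
    convert this using 2
    ring

lemma bddMeas_valueFn (M : MDP X A H) (π : Policy X A H) (h : Fin (H + 1)) :
    BddMeas (valueFn M π h) := .of_Icc .of_discrete (valueFn_mem M π h)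

lemma bddMeas_backup (M : MDP X A H) (π : Policy X A H) (h : Fin H) (x : X) :
    BddMeas (fun a => backup M h (valueFn M π h.succ) x a) :=
  .of_Icc .of_discrete fun a => backup_mem (valueFn_mem M π h.succ) x a

lemma bddMeas_reward_add (M : MDP X A H) (π : Policy X A H) (h : Fin (H + 1)) :
    BddMeas (fun q : unitInterval × X => (q.1 : ℝ) + valueFn M π h q.2) :=
  (BddMeas.of_Icc (a := 0) (b := 1) (by fun_prop) fun q => q.1.2).add
    ((bddMeas_valueFn M π h).comp measurable_snd)

lemma backup_eq (M : MDP X A H) (h : Fin H) {W : X → ℝ} (hW : BddMeas W) (x : X) (a : A) :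
    backup M h W x a = ∫ r, (r : ℝ) ∂(M.rew h x a : Measure unitInterval) +
      ∫ y, W y ∂(M.trans h x a : Measure X) := by
  have b1 : BddMeas (fun q : unitInterval × X => (q.1 : ℝ)) :=
    .of_Icc (a := 0) (b := 1) (by fun_prop) fun q => q.1.2
  have b1' : BddMeas (fun q : unitInterval => (q : ℝ)) :=
    .of_Icc (a := 0) (b := 1) (by fun_prop) fun q => q.2
  have b2 : BddMeas (fun q : unitInterval × X => W q.2) := hW.comp measurable_snd
  unfold backup MDP.joint
  rw [integral_add (b1.integrable _) (b2.integrable _)]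
  congr 1
  · rw [integral_fun_fst (μ := (M.rew h x a : Measure unitInterval))
      (fun r : unitInterval => (r : ℝ))]
    simp
  · rw [integral_fun_snd (ν := (M.trans h x a : Measure X)) W]
    simp

/-- The expected reward of the first `n` steps plus the value of the state reached does not depend
on `n`. -/
lemma integral_history_valueFn (M : MDP X A H) (π : Policy X A H) (x : X) :
    ∀ (n : ℕ) (hn : n ≤ H), ∫ w, (∑ j, ((w j).2.1 : ℝ) +
        valueFn M π ⟨n, Nat.lt_succ_of_le hn⟩ (Traj.state (x, w) (Fin.last n)))
      ∂(historyKernel (stepKernel M) n hn (π, x)) = valueFn M π 0 x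
  | 0, _ => by
      simp only [historyKernel, Kernel.const_apply]
      rw [integral_dirac]
      simp [Traj.state]
  | n + 1, hn => by
      have ih := integral_history_valueFn M π x n (Nat.le_of_succ_le hn)
      have i1 := isMarkovKernel_historyKernel (stepKernel M) (fun _ => inferInstance) n
        (Nat.le_of_succ_le hn)
      have i2 : ∀ h, IsMarkovKernel (stepKernel M h) := fun _ => inferInstance
      have i3 := i2 ⟨n, hn⟩
      set W := valueFn M π ⟨n + 1, Nat.lt_succ_of_le hn⟩ with hWdef
      have bW : BddMeas W := bddMeas_valueFn ..
      have br : ∀ m : ℕ, BddMeas (fun w : Fin m → Step X A => ∑ j, ((w j).2.1 : ℝ)) := fun m =>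
        BddMeas.sum _ fun j _ => .of_Icc (a := 0) (b := 1) (by fun_prop) fun w => (w j).2.1.2
      have bt : BddMeas (fun w : Fin (n + 1) → Step X A => ∑ j, ((w j).2.1 : ℝ) +
          W (Traj.state (x, w) (Fin.last (n + 1)))) :=
        (br _).add (bW.comp ((Traj.measurable_state _).comp measurable_prodMk_left))
      rw [← ih]
      simp only [historyKernel]
      rw [Kernel.map_apply _ (measurable_snoc n), Kernel.compProd_apply_eq_compProd_sectR,
        integral_map (measurable_snoc n).aemeasurable bt.meas.aestronglyMeasurable,
        Measure.integral_compProd ((bt.comp (measurable_snoc n)).integrable _)]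
      congr 1
      ext w
      rw [Kernel.sectR_apply, stepKernel_apply M ⟨n, hn⟩]
      set y := Traj.state (x, w) (Fin.last n)
      simp only [state_snoc_last, Fin.sum_univ_castSucc, Fin.snoc_castSucc, Fin.snoc_last]
      have b2 : BddMeas (fun q : unitInterval × X => (q.1 : ℝ) + W q.2) :=
        bddMeas_reward_add M π ⟨n + 1, Nat.lt_succ_of_le hn⟩
      have b2' : BddMeas (fun s : Step X A => (s.2.1 : ℝ) + W s.2.2) := b2.comp measurable_snd
      have hv : valueFn M π ⟨n, Nat.lt_succ_of_le (Nat.le_of_succ_le hn)⟩ y =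
          ∫ a, backup M ⟨n, hn⟩ W y a ∂(π ⟨n, hn⟩ y : Measure A) :=
        valueFn_castSucc M π ⟨n, hn⟩ y
      simp only [add_assoc]
      rw [integral_add (integrable_const _) (b2'.integrable _),
        Measure.integral_compProd (b2'.integrable _), hv]
      simp only [integral_const, probReal_univ, one_smul]
      rfl

lemma value_eq_integral_valueFn (M : MDP X A H) (π : Policy X A H) :
    value M π = ∫ x, valueFn M π 0 x ∂(M.init : Measure X) := by
  have i1 := isMarkovKernel_historyKernel (stepKernel M) (fun _ => inferInstance) H le_rfl
  have bt : BddMeas (Traj.ret : Traj X A H → ℝ) :=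
    BddMeas.sum _ fun j _ => .of_Icc (a := 0) (b := 1) (by fun_prop) fun w => (w.2 j).2.1.2
  rw [value, trajKernel, Kernel.compProd_apply_eq_compProd_sectR,
    Measure.integral_compProd (bt.integrable _)]
  congr 1
  ext x
  rw [← integral_history_valueFn M π x H le_rfl, Kernel.sectR_apply]
  congr 1
  ext w
  have : valueFn M π ⟨H, Nat.lt_succ_of_le le_rfl⟩ = valueFn M π (Fin.last H) := rfl
  rw [this, valueFn_last, add_zero]
  rfl

lemma value_mem (M : MDP X A H) (π : Policy X A H) : value M π ∈ Set.Icc (0 : ℝ) H := by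
  rw [value_eq_integral_valueFn]
  refine integral_mem_Icc .of_discrete fun x => ?_
  simpa using valueFn_mem M π 0 x

lemma bddAbove_value (M : MDP X A H) : BddAbove (Set.range (value M)) :=
  ⟨H, by rintro _ ⟨π, rfl⟩; exact (value_mem M π).2⟩

lemma value_le_optValue (M : MDP X A H) (π : Policy X A H) : value M π ≤ optValue M :=
  le_ciSup (bddAbove_value M) π

lemma optValue_mem (M : MDP X A H) : optValue M ∈ Set.Icc (0 : ℝ) H := by
  refine ⟨Real.iSup_nonneg fun π => (value_mem M π).1, ?_⟩
  rcases isEmpty_or_nonempty (Policy X A H) with h | h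
  · simp [optValue]
  · exact ciSup_le fun π => (value_mem M π).2

/-! ### Latent dynamics -/

/-- A policy of the observable MDP, averaged over the emissions of each latent state. -/
noncomputable def emissionAverage (ψ : Emission S X H) (π : Policy X A H) : Policy S A H :=
  fun h s =>
  ⟨(ψ h.castSucc s : Measure X).bind (fun x => (π h x : Measure A)),
    isProbabilityMeasure_bind (Measurable.of_discrete).aemeasurable
      (Filter.Eventually.of_forall fun x => (π h x).2)⟩

lemma backup_latentDynamics (M : MDP S A H) (ψ : Emission S X H) (φ : Decoder X S H) (h : Fin H)
    {W : X → ℝ} (hW : BddMeas W) (x : X) (a : A) :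
    backup (latentDynamics M ψ φ) h W x a =
      backup M h (fun s => ∫ y, W y ∂(ψ h.succ s : Measure X)) (φ h.castSucc x) a := by
  have b : BddMeas (fun s => ∫ y, W y ∂(ψ h.succ s : Measure X)) := by
    have hm : IsMarkovKernel (Kernel.ofFunOfCountable fun s => (ψ h.succ s : Measure X)) :=
      ⟨fun s => (ψ h.succ s).2⟩
    exact hW.integral_kernel' (Kernel.ofFunOfCountable fun s => (ψ h.succ s : Measure X))
  rw [backup_eq _ _ hW, backup_eq _ _ b]
  congr 1
  exact integral_bind_probabilityMeasure _ _ hW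

/-- Given the latent state, the observation is a fresh emission, so that averaging a policy over
emissions does not change its value. -/
lemma integral_valueFn_latentDynamics (M : MDP S A H) (ψ : Emission S X H) (φ : Decoder X S H)
    (hφ : IsDecoder ψ φ) (π : Policy X A H) (h : Fin (H + 1)) :
    ∀ s, ∫ x, valueFn (latentDynamics M ψ φ) π h x ∂(ψ h s : Measure X) =
      valueFn M (emissionAverage ψ π) h s := by
  induction h using Fin.reverseInduction with
  | last => intro s; simp [valueFn_last]
  | cast h ih =>
    intro s
    have hs : ∀ᵐ x ∂(ψ h.castSucc s : Measure X), valueFn (latentDynamics M ψ φ) π h.castSucc x =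
        ∫ a, backup M h (valueFn M (emissionAverage ψ π) h.succ) s a ∂(π h x : Measure A) := by
      refine ae_iff_of_countable.2 fun x hx => ?_
      rw [valueFn_castSucc]
      simp only [backup_latentDynamics M ψ φ h (bddMeas_valueFn _ π h.succ), ih,
        hφ h.castSucc s x hx]
    rw [integral_congr_ae hs, valueFn_castSucc]
    exact (integral_bind_probabilityMeasure _ _ (bddMeas_backup M _ h s)).symm

lemma value_latentDynamics (M : MDP S A H) (ψ : Emission S X H) (φ : Decoder X S H)
    (hφ : IsDecoder ψ φ) (π : Policy X A H) :
    value (latentDynamics M ψ φ) π = value M (emissionAverage ψ π) := by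
  rw [value_eq_integral_valueFn, value_eq_integral_valueFn]
  simp only [← integral_valueFn_latentDynamics M ψ φ hφ π]
  exact integral_bind_probabilityMeasure _ _ (bddMeas_valueFn _ π 0)

lemma optValue_latentDynamics_le (M : MDP S A H) (ψ : Emission S X H) (φ : Decoder X S H)
    (hφ : IsDecoder ψ φ) : optValue (latentDynamics M ψ φ) ≤ optValue M :=
  Real.iSup_le (fun π => by
    rw [value_latentDynamics M ψ φ hφ]; exact value_le_optValue M _) (optValue_mem M).1

/-! ### Measurability in the model -/

lemma measurable_init : Measurable (fun M : MDP X A H => (M.init : Measure X)) :=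
  measurable_subtype_coe.comp (measurable_fst.comp (comap_measurable _))

lemma measurable_trans (h : Fin H) (x : X) (a : A) :
    Measurable (fun M : MDP X A H => (M.trans h x a : Measure X)) := by
  have h1 : Measurable (fun M : MDP X A H => M.trans) :=
    measurable_fst.comp (measurable_snd.comp (comap_measurable _))
  exact measurable_subtype_coe.comp ((measurable_pi_apply a).comp ((measurable_pi_apply x).comp
    ((measurable_pi_apply h).comp h1)))

lemma measurable_rew (h : Fin H) (x : X) (a : A) :
    Measurable (fun M : MDP X A H => (M.rew h x a : Measure unitInterval)) := by
  have h1 : Measurable (fun M : MDP X A H => M.rew) :=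
    measurable_snd.comp (measurable_snd.comp (comap_measurable _))
  exact measurable_subtype_coe.comp ((measurable_pi_apply a).comp ((measurable_pi_apply x).comp
    ((measurable_pi_apply h).comp h1)))

/-- The initial law, as a kernel from models. -/
noncomputable def initKernel : Kernel (MDP X A H) X := ⟨fun M => M.init, measurable_init⟩

instance : IsMarkovKernel (initKernel : Kernel (MDP X A H) X) := ⟨fun M => M.init.2⟩

/-- The joint law of reward and next state, as a kernel from models. -/
noncomputable def jointKernel (h : Fin H) (x : X) (a : A) : Kernel (MDP X A H) (unitInterval × X) :=
  Kernel.prod ⟨fun M => M.rew h x a, measurable_rew h x a⟩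
    ⟨fun M => M.trans h x a, measurable_trans h x a⟩

lemma jointKernel_apply (h : Fin H) (x : X) (a : A) (M : MDP X A H) :
    jointKernel h x a M = M.joint h x a := by
  have i1 : IsMarkovKernel (⟨fun M => M.rew h x a, measurable_rew h x a⟩ :
    Kernel (MDP X A H) unitInterval) := ⟨fun M => (M.rew h x a).2⟩
  have i2 : IsMarkovKernel (⟨fun M => M.trans h x a, measurable_trans h x a⟩ :
    Kernel (MDP X A H) X) := ⟨fun M => (M.trans h x a).2⟩
  rw [jointKernel, Kernel.prod_apply]
  rfl

instance (h : Fin H) (x : X) (a : A) :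
    IsMarkovKernel (jointKernel h x a : Kernel (MDP X A H) (unitInterval × X)) :=
  ⟨fun M => by rw [jointKernel_apply]; infer_instance⟩

/-- Deterministic policies. -/
noncomputable def detPolicy (f : Fin H → X → A) : Policy X A H :=
  fun h x => ⟨Measure.dirac (f h x), Measure.dirac.isProbabilityMeasure⟩

lemma valueFn_detPolicy_castSucc (M : MDP X A H) (f : Fin H → X → A) (h : Fin H) (x : X) :
    valueFn M (detPolicy f) h.castSucc x =
      backup M h (valueFn M (detPolicy f) h.succ) x (f h x) := by
  rw [valueFn_castSucc]
  exact integral_dirac _ _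

lemma measurable_valueFn_detPolicy (f : Fin H → X → A) (h : Fin (H + 1)) :
    ∀ x, Measurable (fun M : MDP X A H => valueFn M (detPolicy f) h x) := by
  induction h using Fin.reverseInduction with
  | last => intro x; simp [valueFn_last]
  | cast h ih =>
    intro x
    simp only [valueFn_detPolicy_castSucc, backup, ← jointKernel_apply]
    refine (StronglyMeasurable.integral_kernel_prod_right
      (f := fun (M : MDP X A H) (q : unitInterval × X) =>
        (q.1 : ℝ) + valueFn M (detPolicy f) h.succ q.2)
      (Measurable.stronglyMeasurable ?_)).measurable
    refine Measurable.add (by fun_prop) ?_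
    have : Measurable fun p : MDP X A H × X => valueFn p.1 (detPolicy f) h.succ p.2 :=
      measurable_from_prod_countable_left ih
    exact this.comp (measurable_fst.prodMk (measurable_snd.comp measurable_snd))

lemma measurable_value_detPolicy (f : Fin H → X → A) :
    Measurable (fun M : MDP X A H => value M (detPolicy f)) := by
  simp only [value_eq_integral_valueFn]
  refine (StronglyMeasurable.integral_kernel_prod_right (κ := initKernel)
      (f := fun (M : MDP X A H) (x : X) => valueFn M (detPolicy f) 0 x)
      (Measurable.stronglyMeasurable ?_)).measurable
  exact measurable_from_prod_countable_left (measurable_valueFn_detPolicy f 0)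

/-! ### A countable family of policies that suffices for the optimal value -/

/-- Policy improvement: some deterministic policy is at least as good as `π`. -/
lemma exists_value_le_detPolicy (M : MDP X A H) (π : Policy X A H) :
    ∃ f : Fin H → X → A, value M π ≤ value M (detPolicy f) := by
  -- in each state some action is at least as good as the average action of `π`
  have hex : ∀ (h : Fin H) (x : X), ∃ a, ∫ a, backup M h (valueFn M π h.succ) x a
      ∂(π h x : Measure A) ≤ backup M h (valueFn M π h.succ) x a := fun h x =>
    exists_integral_le ((bddMeas_backup M π h x).integrable _)
  choose f hf using hex
  refine ⟨f, ?_⟩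
  have key : ∀ h : Fin (H + 1), ∀ x, valueFn M π h x ≤ valueFn M (detPolicy f) h x := by
    intro h
    induction h using Fin.reverseInduction with
    | last => intro x; simp [valueFn_last]
    | cast h ih =>
      intro x
      rw [valueFn_castSucc, valueFn_detPolicy_castSucc]
      refine (hf h x).trans ?_
      refine integral_mono ((bddMeas_reward_add M _ _).integrable _)
        ((bddMeas_reward_add M _ _).integrable _) fun q => ?_
      simpa using ih q.2
  rw [value_eq_integral_valueFn, value_eq_integral_valueFn]
  exact integral_mono ((bddMeas_valueFn M _ _).integrable _) ((bddMeas_valueFn M _ _).integrable _)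
    fun x => key 0 x

lemma tendsto_value_detPolicy (M : MDP X A H) (f : Fin H → X → A) (F : ℕ → Fin H → X → A)
    (hF : ∀ h x, ∀ᶠ n in Filter.atTop, F n h x = f h x) :
    Filter.Tendsto (fun n => value M (detPolicy (F n))) Filter.atTop
      (nhds (value M (detPolicy f))) := by
  have key : ∀ h : Fin (H + 1), ∀ x, Filter.Tendsto (fun n => valueFn M (detPolicy (F n)) h x)
      Filter.atTop (nhds (valueFn M (detPolicy f) h x)) := by
    intro h
    induction h using Fin.reverseInduction with
    | last => intro x; simp [valueFn_last]
    | cast h ih =>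
      intro x
      simp only [valueFn_detPolicy_castSucc]
      have : Filter.Tendsto (fun n => backup M h (valueFn M (detPolicy (F n)) h.succ) x (f h x))
          Filter.atTop (nhds (backup M h (valueFn M (detPolicy f) h.succ) x (f h x))) := by
        refine tendsto_integral_of_dominated_convergence (fun _ => 1 + H)
          (fun n => (bddMeas_reward_add M _ _).meas.aestronglyMeasurable) (integrable_const _)
          (fun n => Filter.Eventually.of_forall fun q => ?_)
          (Filter.Eventually.of_forall fun q => (ih q.2).const_add _)
        have h1 := q.1.2
        have h2 := valueFn_mem M (detPolicy (F n)) h.succ q.2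
        have h3 : (0 : ℝ) ≤ (h.succ : ℕ) := Nat.cast_nonneg _
        rw [Real.norm_eq_abs, abs_of_nonneg (add_nonneg h1.1 h2.1)]
        linarith [h1.2, h2.2]
      refine this.congr' ?_
      filter_upwards [hF h x] with n hn
      rw [hn]
  simp only [value_eq_integral_valueFn]
  refine tendsto_integral_of_dominated_convergence (fun _ => H)
    (fun n => (bddMeas_valueFn M _ _).meas.aestronglyMeasurable) (integrable_const _)
    (fun n => Filter.Eventually.of_forall fun x => ?_) (Filter.Eventually.of_forall (key 0))
  have h2 := valueFn_mem M (detPolicy (F n)) 0 x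
  rw [Real.norm_eq_abs, abs_of_nonneg h2.1]
  simpa using h2.2

/-- There is a sequence of policies that is optimal, in the supremum, for all models at once:
deterministic policies that differ from a fixed one in finitely many states. -/
lemma exists_seq_policy_optValue_eq_iSup [Nonempty A] :
    ∃ p : ℕ → Policy X A H, (∀ i, Measurable fun M => value M (p i)) ∧
      ∀ M : MDP X A H, optValue M = ⨆ i, value M (p i) := by
  obtain ⟨ι, hι⟩ := exists_injective_nat X
  let a₀ : A := Classical.arbitrary A
  let pol : (Fin H → List A) → Policy X A H := fun L =>
    detPolicy fun h x => (L h).getD (ι x) a₀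
  obtain ⟨e, he⟩ := exists_surjective_nat (Fin H → List A)
  refine ⟨fun i => pol (e i), fun i => measurable_value_detPolicy _, fun M => ?_⟩
  have hb : BddAbove (Set.range fun i => value M (pol (e i))) :=
    ⟨H, by rintro _ ⟨i, rfl⟩; exact (value_mem M _).2⟩
  have : Nonempty (Policy X A H) := ⟨pol fun _ => []⟩
  refine le_antisymm (ciSup_le fun π => ?_) (ciSup_le fun i => value_le_optValue M _)
  obtain ⟨f, hf⟩ := exists_value_le_detPolicy M π
  refine hf.trans ?_
  classical
  let g : Fin H → ℕ → A := fun h i => if hx : ∃ x, ι x = i then f h hx.choose else a₀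
  have hg : ∀ h x, g h (ι x) = f h x := fun h x => by
    have hx : ∃ y, ι y = ι x := ⟨x, rfl⟩
    simp only [g, dif_pos hx, hι hx.choose_spec]
  refine le_of_tendsto' (tendsto_value_detPolicy M f
    (fun n h x => ((List.range n).map (g h)).getD (ι x) a₀) fun h x => ?_) fun n => ?_
  · filter_upwards [Filter.eventually_gt_atTop (ι x)] with n hn
    rw [← hg h x]
    simp [hn]
  · obtain ⟨i, hi⟩ := he fun h => (List.range n).map (g h)
    have := le_ciSup hb i
    simp only [hi] at this
    exact this

lemma measurable_optValue [Nonempty A] : Measurable (optValue : MDP X A H → ℝ) := by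
  obtain ⟨p, hp, hopt⟩ := exists_seq_policy_optValue_eq_iSup (X := X) (A := A) (H := H)
  rw [funext hopt]
  exact Measurable.iSup hp

lemma exists_measurable_nearOptimal [Nonempty A] {ε : ℝ} (hε : 0 < ε) :
    ∃ sel : MDP X A H → Policy X A H, Measurable sel ∧
      ∀ M, optValue M - ε ≤ value M (sel M) := by
  classical
  obtain ⟨p, hp, hopt⟩ := exists_seq_policy_optValue_eq_iSup (X := X) (A := A) (H := H)
  have hex : ∀ M : MDP X A H, ∃ i, optValue M - ε ≤ value M (p i) := fun M => by
    obtain ⟨i, hi⟩ := exists_lt_of_lt_ciSup (f := fun i => value M (p i)) (b := optValue M - ε)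
      (by rw [← hopt]; linarith)
    exact ⟨i, hi.le⟩
  refine ⟨fun M => p (Nat.find (hex M)), ?_, fun M => Nat.find_spec (hex M)⟩
  exact (measurable_from_nat (f := p)).comp (measurable_find hex fun i =>
    measurableSet_le (measurable_optValue.sub_const ε) (hp i))

/-! ### Measurability of the self-predictive error -/

lemma measurable_hellingerSq_kernel {α γ : Type*} [MeasurableSpace α] [MeasurableSpace γ]
    [MeasurableSpace.CountableOrCountablyGenerated α γ] (κ η : Kernel α γ) [IsMarkovKernel κ]
    [IsMarkovKernel η] : Measurable fun a => hellingerSq (κ a) (η a) := by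
  have h : ∀ a, hellingerSq (κ a) (η a) =
      ∫ x, (√(κ.rnDeriv (κ + η) a x).toReal - √(η.rnDeriv (κ + η) a x).toReal) ^ 2
        ∂((κ + η) a) := by
    intro a
    unfold hellingerSq
    rw [add_apply]
    refine integral_congr_ae ?_
    have h1 := Kernel.rnDeriv_eq_rnDeriv_measure (κ := κ) (η := κ + η) (a := a)
    have h2 := Kernel.rnDeriv_eq_rnDeriv_measure (κ := η) (η := κ + η) (a := a)
    rw [add_apply] at h1 h2
    filter_upwards [h1, h2] with x e1 e2
    rw [e1, e2]
  simp only [h]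
  refine (StronglyMeasurable.integral_kernel_prod_right (κ := κ + η) (f := fun a x =>
    (√(κ.rnDeriv (κ + η) a x).toReal - √(η.rnDeriv (κ + η) a x).toReal) ^ 2)
    (Measurable.stronglyMeasurable ?_)).measurable
  exact (((Kernel.measurable_rnDeriv κ (κ + η)).ennreal_toReal.sqrt).sub
    ((Kernel.measurable_rnDeriv η (κ + η)).ennreal_toReal.sqrt)).pow_const 2

/-- The image of a fixed law under a map that depends on a parameter, as a kernel. -/
noncomputable def mapKernel {Θ Ω Ω' : Type*} [MeasurableSpace Θ] [MeasurableSpace Ω]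
    [MeasurableSpace Ω']
    (μ : Measure Ω) (g : Θ × Ω → Ω') : Kernel Θ Ω' :=
  (Kernel.id ×ₖ Kernel.const Θ μ).map g

lemma mapKernel_apply {Θ Ω Ω' : Type*} [MeasurableSpace Θ] [MeasurableSpace Ω]
    [MeasurableSpace Ω'] (μ : Measure Ω) [IsProbabilityMeasure μ] {g : Θ × Ω → Ω'}
    (hg : Measurable g) (θ : Θ) : mapKernel μ g θ = μ.map fun ω => g (θ, ω) := by
  rw [mapKernel, Kernel.map_apply _ hg, Kernel.prod_apply, Kernel.id_apply, Kernel.const_apply,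
    Measure.dirac_prod, Measure.map_map hg measurable_prodMk_left]
  rfl

lemma isMarkovKernel_mapKernel {Θ Ω Ω' : Type*} [MeasurableSpace Θ] [MeasurableSpace Ω]
    [MeasurableSpace Ω'] (μ : Measure Ω) [IsProbabilityMeasure μ] {g : Θ × Ω → Ω'}
    (hg : Measurable g) : IsMarkovKernel (mapKernel μ g) :=
  Kernel.IsMarkovKernel.map _ hg

lemma measurable_decoder_eval (i : Fin (H + 1)) :
    Measurable (fun q : Decoder X S H × X => q.1 i q.2) :=
  measurable_from_prod_countable_left fun x => (measurable_pi_apply x).comp (measurable_pi_apply i)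

lemma measurable_selfPredErr (Mobs : MDP X A H) (h : Fin H) (x : X) (a : A) :
    Measurable fun e : MDP S A H × Decoder X S H => selfPredErr Mobs e.1 e.2 h x a := by
  have hg : Measurable fun p : (MDP S A H × Decoder X S H) × unitInterval × X =>
      (p.2.1, p.1.2 h.succ p.2.2) :=
    (measurable_fst.comp measurable_snd).prodMk ((measurable_decoder_eval h.succ).comp
      ((measurable_snd.comp measurable_fst).prodMk (measurable_snd.comp measurable_snd)))
  have i1 := isMarkovKernel_mapKernel (Mobs.joint h x a) hg
  have hm : Measurable fun e : MDP S A H × Decoder X S H => e.1.joint h (e.2 h.castSucc x) a := by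
    have h1 : Measurable fun q : MDP S A H × S => q.1.joint h q.2 a :=
      measurable_from_prod_countable_left fun s => by
        have hk := (jointKernel h s a : Kernel (MDP S A H) (unitInterval × S)).measurable
        rwa [show ⇑(jointKernel h s a : Kernel (MDP S A H) (unitInterval × S)) =
          fun M => M.joint h s a from funext (jointKernel_apply h s a)] at hk
    exact h1.comp (measurable_fst.prodMk
      ((measurable_pi_apply x).comp ((measurable_pi_apply h.castSucc).comp measurable_snd)))
  have i2 : IsMarkovKernel (⟨_, hm⟩ : Kernel (MDP S A H × Decoder X S H) (unitInterval × S)) :=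
    ⟨fun e => inferInstanceAs (IsProbabilityMeasure (e.1.joint h (e.2 h.castSucc x) a))⟩
  have := measurable_hellingerSq_kernel
    (⟨_, hm⟩ : Kernel (MDP S A H × Decoder X S H) (unitInterval × S))
    (mapKernel (Mobs.joint h x a) fun p => (p.2.1, p.1.2 h.succ p.2.2))
  simp only [mapKernel_apply _ hg] at this
  exact this

lemma measurable_selfPredErrInit (Mobs : MDP X A H) :
    Measurable fun e : MDP S A H × Decoder X S H => selfPredErrInit Mobs e.1 e.2 := by
  have hg : Measurable fun p : (MDP S A H × Decoder X S H) × X => p.1.2 0 p.2 :=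
    (measurable_decoder_eval 0).comp ((measurable_snd.comp measurable_fst).prodMk measurable_snd)
  have i1 := isMarkovKernel_mapKernel (Mobs.init : Measure X) hg
  have := measurable_hellingerSq_kernel
    ((initKernel : Kernel (MDP S A H) S).comap (Prod.fst : MDP S A H × Decoder X S H → _)
      measurable_fst) (mapKernel (Mobs.init : Measure X) fun p => p.1.2 0 p.2)
  simp only [mapKernel_apply _ hg] at this
  exact this

lemma bddMeas_trajErr_joint (Mobs : MDP X A H) :
    BddMeas fun p : (MDP S A H × Decoder X S H) × Traj X A H => trajErr Mobs p.1.1 p.1.2 p.2 := by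
  refine ((BddMeas.of_Icc (measurable_selfPredErrInit Mobs) fun _ => selfPredErrInit_mem ..).comp
    measurable_fst).add (BddMeas.sum _ fun h _ => ?_)
  have h1 : Measurable fun q : (MDP S A H × Decoder X S H) × (X × A) =>
      selfPredErr Mobs q.1.1 q.1.2 h q.2.1 q.2.2 :=
    measurable_from_prod_countable_left fun p => measurable_selfPredErr Mobs h p.1 p.2
  have hm : Measurable (fun τ : Traj X A H => (τ.state h.castSucc, (τ.2 h).1)) :=
    (Traj.measurable_state h.castSucc).prodMk
      (measurable_fst.comp ((measurable_pi_apply h).comp measurable_snd))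
  exact (BddMeas.of_Icc h1 fun _ => selfPredErr_mem ..).comp
    (measurable_fst.prodMk (hm.comp measurable_snd))

lemma bddMeas_expectedSelfPredErr (Mobs : MDP X A H) :
    BddMeas fun p : (MDP S A H × Decoder X S H) × Policy X A H =>
      expectedSelfPredErr Mobs p.1.1 p.1.2 p.2 := by
  have := ((bddMeas_trajErr_joint (S := S) Mobs).comp
    (φ := fun q : ((MDP S A H × Decoder X S H) × Policy X A H) × Traj X A H => (q.1.1, q.2))
    (by fun_prop)).integral_kernel
      ((trajKernel Mobs).comap
        (Prod.snd : (MDP S A H × Decoder X S H) × Policy X A H → _) measurable_snd)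
  simp only [Kernel.comap_apply, integral_trajErr] at this
  exact this

lemma bddMeas_value (M : MDP X A H) : BddMeas (value M) := by
  have bt : BddMeas (Traj.ret : Traj X A H → ℝ) :=
    BddMeas.sum _ fun j _ => .of_Icc (a := 0) (b := 1) (by fun_prop) fun w => (w.2 j).2.1.2
  exact bt.integral_kernel' (trajKernel M)

/-! ### The reduction as an instance of the online protocol -/

/-- The adaptive choice of policies in which the distribution `p_t` is a fixed function `D` of the
current estimate of the oracle. -/
noncomputable def Strategy.ofKernel (T : ℕ) (D : Kernel (MDP S A H × Decoder X S H) (Policy X A H))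
    [IsMarkovKernel D] : Strategy X S A H T where
  dist _ := D.comap Prod.snd measurable_snd
  isMarkov _ := inferInstance

/-- The regret of one round in which `D` is played. -/
noncomputable def roundRegret (D : Kernel (MDP S A H × Decoder X S H) (Policy X A H))
    (Mstar : MDP S A H) (Mobs : MDP X A H) (γ : ℝ) (e : MDP S A H × Decoder X S H) : ℝ :=
  ∫ π, expectedSelfPredErr Mobs e.1 e.2 π ∂(D e) + γ⁻¹ * (optValue Mstar - optValue e.1)

lemma optSelfPredRegret_ofKernel (D : Kernel (MDP S A H × Decoder X S H) (Policy X A H))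
    [IsMarkovKernel D] (Mstar : MDP S A H) (Mobs : MDP X A H) (γ : ℝ) (w : Fin T → Round X S A H) :
    optSelfPredRegret (Strategy.ofKernel T D) Mstar Mobs γ w =
      ∑ t, roundRegret D Mstar Mobs γ (w t).1 := rfl

lemma bddMeas_optValue_fst [Nonempty A] :
    BddMeas fun e : MDP S A H × Decoder X S H => optValue e.1 :=
  .of_Icc (measurable_optValue.comp measurable_fst) fun _ => optValue_mem _

lemma bddMeas_roundRegret [Nonempty A] (D : Kernel (MDP S A H × Decoder X S H) (Policy X A H))
    [IsMarkovKernel D] (Mstar : MDP S A H) (Mobs : MDP X A H) (γ : ℝ) :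
    BddMeas (roundRegret D Mstar Mobs γ) :=
  ((bddMeas_expectedSelfPredErr Mobs).integral_kernel D).add
    (((BddMeas.const _).sub bddMeas_optValue_fst).const_mul _)

lemma isProbabilityMeasure_protocolLaw (rep : RepOracle X S A H T) (str : Strategy X S A H T)
    (Mobs : MDP X A H) : IsProbabilityMeasure (protocolLaw rep str Mobs) :=
  (isMarkovKernel_historyKernel (roundKernel rep str Mobs) (fun _ => inferInstance) T
    le_rfl).isProbabilityMeasure ()

lemma isProbabilityMeasure_o2lLaw (rep : RepOracle X S A H T) (alg : BaseAlg S A H K)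
    (Mobs : MDP X A H) : IsProbabilityMeasure (o2lLaw rep alg Mobs) :=
  (isMarkovKernel_historyKernel (epochKernel rep alg Mobs) (fun _ => inferInstance) T
    le_rfl).isProbabilityMeasure ()

lemma integral_optSelfPredRegret_ofKernel [Nonempty A] (rep : RepOracle X S A H T)
    (D : Kernel (MDP S A H × Decoder X S H) (Policy X A H)) [IsMarkovKernel D]
    (Mstar : MDP S A H) (Mobs : MDP X A H) (γ : ℝ) :
    ∫ w, optSelfPredRegret (Strategy.ofKernel T D) Mstar Mobs γ w
        ∂(protocolLaw rep (Strategy.ofKernel T D) Mobs) =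
      ∑ t, ∫ w, roundRegret D Mstar Mobs γ (w t).1
        ∂(protocolLaw rep (Strategy.ofKernel T D) Mobs) := by
  have := isProbabilityMeasure_protocolLaw rep (Strategy.ofKernel T D) Mobs
  simp only [optSelfPredRegret_ofKernel]
  exact integral_finsetSum _ fun t _ => (((bddMeas_roundRegret D Mstar Mobs γ).comp
    measurable_fst).comp (measurable_pi_apply t)).integrable _

lemma integral_roundKernel (rep : RepOracle X S A H T)
    (D : Kernel (MDP S A H × Decoder X S H) (Policy X A H)) [IsMarkovKernel D]
    (Mobs : MDP X A H) (t : Fin T) (w : Fin t → Round X S A H) {F : Round X S A H → ℝ}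
    (hF : BddMeas F) :
    ∫ r, F r ∂(roundKernel rep (Strategy.ofKernel T D) Mobs t ((), w)) =
      ∫ e, ∫ p, F (e, p) ∂(D e ⊗ₘ trajKernel Mobs)
        ∂(rep.estimate t fun i => ((w i).1, (w i).2.2)) := by
  have := rep.isMarkov t
  have := (Strategy.ofKernel (X := X) (S := S) (A := A) (H := H) T D).isMarkov t
  rw [roundKernel, Kernel.compProd_apply_eq_compProd_sectR,
    Measure.integral_compProd (hF.integrable _), Kernel.comap_apply]
  congr 1
  ext e
  rw [Kernel.sectR_apply, Kernel.compProd_apply_eq_compProd_sectR, Kernel.comap_apply]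
  rfl

lemma integral_epochKernel (rep : RepOracle X S A H T) (alg : BaseAlg S A H K)
    (Mobs : MDP X A H) (t : Fin T) (w : Fin t → Epoch X S A H K) {F : Epoch X S A H K → ℝ}
    (hF : BddMeas F) :
    ∫ r, F r ∂(epochKernel rep alg Mobs t ((), w)) =
      ∫ e, ∫ y, F (e, y) ∂(runAndSelect alg Mobs e.2) ∂(rep.estimate t (oracleView w)) := by
  have := rep.isMarkov t
  rw [epochKernel, Kernel.compProd_apply_eq_compProd_sectR,
    Measure.integral_compProd (hF.integrable _), Kernel.comap_apply]
  rfl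

lemma measurable_apply_snd {Ω : Type*} [MeasurableSpace Ω] :
    Measurable fun q : (Fin (K + 1) → Ω) × Fin (K + 1) => q.1 q.2 :=
  measurable_from_prod_countable_left fun k => measurable_pi_apply k

lemma integral_runAndSelect (alg : BaseAlg S A H K) (Mobs : MDP X A H) (φ : Decoder X S H)
    {F : (Fin (K + 1) → Policy S A H × Traj X A H) × Fin (K + 1) → ℝ} (hF : BddMeas F) :
    ∫ y, F y ∂(runAndSelect alg Mobs φ) =
      ∫ w, ((K : ℝ) + 1)⁻¹ * ∑ k, F (w, k) ∂(runKernel alg Mobs φ) := by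
  rw [runAndSelect, Kernel.compProd_apply_eq_compProd_sectR,
    Measure.integral_compProd (hF.integrable _)]
  congr 1
  ext w
  rw [Kernel.sectR_apply, Kernel.const_apply, PMF.integral_eq_sum, Finset.mul_sum]
  have hK : ((K : ℝ≥0∞) + 1).toReal = (K : ℝ) + 1 := by
    rw [ENNReal.toReal_add (ENNReal.natCast_ne_top K) ENNReal.one_ne_top]; simp
  simp [hK]

/-- In episode `k` of a run the trajectory has the law of the policy played. -/
lemma integral_runKernel_episode (alg : BaseAlg S A H K) (Mobs : MDP X A H) (φ : Decoder X S H)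
    (k : Fin (K + 1)) {g : Policy S A H × Traj X A H → ℝ} (hg : BddMeas g) :
    ∫ w, g (w k) ∂(runKernel alg Mobs φ) =
      ∫ w, ∫ τ, g ((w k).1, τ) ∂(trajKernel Mobs ((w k).1.comp φ)) ∂(runKernel alg Mobs φ) := by
  set κ := (trajKernel Mobs).comap (fun π : Policy S A H => Policy.comp π φ)
    (measurable_policy_comp.comp measurable_prodMk_left) with hκ
  have hg' : BddMeas fun p : Policy S A H × Traj X A H => ∫ τ, g (p.1, τ) ∂(κ p.1) :=
    (hg.integral_kernel κ).comp measurable_fst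
  have key : ∀ w : Fin k → Policy S A H × Traj X A H, ∫ p, g p ∂(episodeKernel alg Mobs k (φ, w)) =
      ∫ p, ∫ τ, g (p.1, τ) ∂(κ p.1) ∂(episodeKernel alg Mobs k (φ, w)) := fun w => by
    have := alg.isMarkov k
    rw [episodeKernel_apply, Measure.integral_compProd (hg.integrable _),
      Measure.integral_compProd (hg'.integrable _)]
    simp [hκ]
  exact le_antisymm
    (integral_historyKernel_mono (κ := episodeKernel alg Mobs) (fun _ => inferInstance) φ hg hg' k
      (fun w => (key w).le) (K + 1) le_rfl k.isLt)
    (integral_historyKernel_mono (κ := episodeKernel alg Mobs) (fun _ => inferInstance) φ hg' hg k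
      (fun w => (key w).ge) (K + 1) le_rfl k.isLt)

/-- The observation-level policy and the trajectory of the selected episode of a run. -/
noncomputable def selectKernel (alg : BaseAlg S A H K) (Mobs : MDP X A H) :
    Kernel (Decoder X S H) (Policy X A H × Traj X A H) :=
  (Kernel.id ×ₖ runAndSelect alg Mobs).map
    fun q => (Policy.comp (q.2.1 q.2.2).1 q.1, (q.2.1 q.2.2).2)

lemma measurable_select : Measurable fun q : Decoder X S H ×
    ((Fin (K + 1) → Policy S A H × Traj X A H) × Fin (K + 1)) =>
      (Policy.comp (q.2.1 q.2.2).1 q.1, (q.2.1 q.2.2).2) :=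
  (measurable_policy_comp.comp (measurable_fst.prodMk
    (measurable_fst.comp (measurable_apply_snd.comp measurable_snd)))).prodMk
      (measurable_snd.comp (measurable_apply_snd.comp measurable_snd))

instance (alg : BaseAlg S A H K) (Mobs : MDP X A H) : IsMarkovKernel (selectKernel alg Mobs) :=
  Kernel.IsMarkovKernel.map _ measurable_select

lemma selectKernel_apply (alg : BaseAlg S A H K) (Mobs : MDP X A H) (φ : Decoder X S H) :
    selectKernel alg Mobs φ = (runAndSelect alg Mobs φ).map
      fun y => (Policy.comp (y.1 y.2).1 φ, (y.1 y.2).2) := by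
  rw [selectKernel, Kernel.map_apply _ measurable_select, Kernel.prod_apply, Kernel.id_apply,
    Measure.dirac_prod, Measure.map_map measurable_select measurable_prodMk_left]
  rfl

lemma integral_selectKernel (alg : BaseAlg S A H K) (Mobs : MDP X A H) (φ : Decoder X S H)
    {F : Policy X A H × Traj X A H → ℝ} (hF : BddMeas F) :
    ∫ p, F p ∂(selectKernel alg Mobs φ) =
      ((K : ℝ) + 1)⁻¹ * ∑ k, ∫ w, F ((w k).1.comp φ, (w k).2) ∂(runKernel alg Mobs φ) := by
  have hm : Measurable fun y : (Fin (K + 1) → Policy S A H × Traj X A H) × Fin (K + 1) =>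
      (Policy.comp (y.1 y.2).1 φ, (y.1 y.2).2) := measurable_select.comp measurable_prodMk_left
  rw [selectKernel_apply, integral_map hm.aemeasurable hF.meas.aestronglyMeasurable,
    integral_runAndSelect alg Mobs φ (hF.comp hm), integral_const_mul]
  congr 1
  refine integral_finsetSum _ fun k _ => ((hF.comp hm).comp (φ := fun w => (w, k)) ?_).integrable _
  exact measurable_prodMk_right

lemma measurable_comp_left (φ : Decoder X S H) :
    Measurable fun p : Policy S A H × Traj X A H => (p.1.comp φ, p.2) :=
  (measurable_policy_comp.comp (measurable_const.prodMk measurable_fst)).prodMk measurable_snd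

/-- The law of the observation-level policy of the selected episode. -/
noncomputable def selectPolicy (alg : BaseAlg S A H K) (Mobs : MDP X A H) :
    Kernel (MDP S A H × Decoder X S H) (Policy X A H) :=
  (Kernel.fst (selectKernel alg Mobs)).comap Prod.snd measurable_snd

instance (alg : BaseAlg S A H K) (Mobs : MDP X A H) : IsMarkovKernel (selectPolicy alg Mobs) := by
  unfold selectPolicy; infer_instance

lemma integral_selectPolicy (alg : BaseAlg S A H K) (Mobs : MDP X A H)
    (e : MDP S A H × Decoder X S H) {f : Policy X A H → ℝ} (hf : BddMeas f) :
    ∫ π, f π ∂(selectPolicy alg Mobs e) =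
      ((K : ℝ) + 1)⁻¹ * ∑ k, ∫ w, f ((w k).1.comp e.2) ∂(runKernel alg Mobs e.2) := by
  rw [selectPolicy, Kernel.comap_apply, Kernel.fst_apply,
    integral_map (by fun_prop) hf.meas.aestronglyMeasurable]
  exact integral_selectKernel alg Mobs e.2 (hf.comp measurable_fst)

lemma selectPolicy_compProd (alg : BaseAlg S A H K) (Mobs : MDP X A H)
    (e : MDP S A H × Decoder X S H) :
    selectPolicy alg Mobs e ⊗ₘ trajKernel Mobs = selectKernel alg Mobs e.2 := by
  refine measure_eq_of_forall_bddMeas fun F hF => ?_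
  rw [Measure.integral_compProd (hF.integrable _), integral_selectKernel alg Mobs e.2 hF,
    integral_selectPolicy alg Mobs e (hF.integral_kernel (trajKernel Mobs))]
  congr 1
  refine Finset.sum_congr rfl fun k _ => ?_
  exact (integral_runKernel_episode alg Mobs e.2 k (hF.comp (measurable_comp_left e.2))).symm

/-- What an epoch of the reduction means for the online protocol. -/
def Epoch.toRound (r : Epoch X S A H K) : Round X S A H :=
  (r.1, Policy.comp (r.2.1 r.2.2).1 r.1.2, (r.2.1 r.2.2).2)

lemma measurable_toRound : Measurable (Epoch.toRound : Epoch X S A H K → Round X S A H) :=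
  measurable_fst.prodMk (measurable_select.comp
    ((measurable_snd.comp measurable_fst).prodMk measurable_snd))

/-- The reduction is the online protocol in which the policy of a uniformly chosen episode of a run
is played. -/
lemma protocolLaw_eq_map_o2lLaw (rep : RepOracle X S A H T) (alg : BaseAlg S A H K)
    (Mobs : MDP X A H) :
    protocolLaw rep (Strategy.ofKernel T (selectPolicy alg Mobs)) Mobs =
      (o2lLaw rep alg Mobs).map fun w t => Epoch.toRound (w t) := by
  refine historyKernel_map (fun _ => inferInstance) (fun _ => inferInstance) () measurable_toRound
    (fun t w => ?_) T le_rfl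
  have := Measure.isProbabilityMeasure_map (μ := epochKernel rep alg Mobs t ((), w))
    (measurable_toRound (X := X) (S := S) (A := A) (H := H) (K := K)).aemeasurable
  refine measure_eq_of_forall_bddMeas fun F hF => ?_
  rw [integral_map measurable_toRound.aemeasurable hF.meas.aestronglyMeasurable,
    integral_roundKernel rep _ Mobs t _ hF,
    integral_epochKernel rep alg Mobs t w (hF.comp measurable_toRound)]
  congr 1
  ext e
  have hm : Measurable fun y : (Fin (K + 1) → Policy S A H × Traj X A H) × Fin (K + 1) =>
      (Policy.comp (y.1 y.2).1 e.2, (y.1 y.2).2) := measurable_select.comp measurable_prodMk_left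
  rw [selectPolicy_compProd, selectKernel_apply, integral_map hm.aemeasurable
    (hF.comp measurable_prodMk_left).meas.aestronglyMeasurable]
  rfl

/-! ### Simulation bounds -/

lemma HellingerControlled.sq_sub_le {Ω Ω' : Type*} [MeasurableSpace Ω] [MeasurableSpace Ω']
    {P : Measure Ω} {Q : Measure Ω'} [IsProbabilityMeasure P] [IsProbabilityMeasure Q] {c : Ω → Ω'}
    {e : Ω → ℝ} (h : HellingerControlled P Q c e) (hc : Measurable c) {f : Ω' → ℝ}
    (mf : Measurable f) (hf : ∀ ω, f ω ∈ Set.Icc (0 : ℝ) 1) :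
    (∫ ω, f (c ω) ∂P - ∫ ω, f ω ∂Q) ^ 2 ≤ ∫ ω, e ω ∂P := by
  have := h (fun ω => f (c ω)) f (mf.comp hc) mf (fun _ => hf _) hf
  simp only [hellPot_self (hf _), zero_add] at this
  exact ((sq_sub_le_bernHell (integral_mem_Icc (mf.comp hc) fun _ => hf _)
    (integral_mem_Icc mf hf)).trans (bernHell_le_hellPot _ _)).trans this

/-- AM-GM for a difference whose square is at most `6 s`. -/
lemma abs_le_of_sq_le_six_mul {d s l : ℝ} (h : d ^ 2 ≤ 6 * s) (hl : 0 < l) :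
    |d| ≤ l * s + 3 / (2 * l) := by
  have hs : 0 ≤ s := by nlinarith [sq_nonneg d]
  refine abs_le_of_sq_le_sq (h.trans ?_) (by positivity)
  have e : (l * s + 3 / (2 * l)) ^ 2 = (l * s - 3 / (2 * l)) ^ 2 + 6 * s := by
    field_simp; ring
  rw [e]
  nlinarith [sq_nonneg (l * s - 3 / (2 * l))]

lemma value_eq_integral_min (M : MDP X A H) (hM : BoundedReturn M) (π : Policy X A H) :
    value M π = ∫ τ, min τ.ret 1 ∂(trajKernel M π) :=
  integral_congr_ae ((hM π).mono fun _ hτ => (min_eq_left hτ).symm)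

lemma measurable_min_ret : Measurable fun τ : Traj X A H => min τ.ret 1 := by
  unfold Traj.ret; fun_prop

lemma min_ret_mem (τ : Traj X A H) : min τ.ret 1 ∈ Set.Icc (0 : ℝ) 1 :=
  ⟨le_min (Finset.sum_nonneg fun h _ => (τ.2 h).2.1.2.1) zero_le_one, min_le_right _ _⟩

lemma value_le_one {M : MDP X A H} (hM : BoundedReturn M) (π : Policy X A H) : value M π ≤ 1 := by
  rw [value_eq_integral_min M hM]
  exact (integral_mem_Icc measurable_min_ret min_ret_mem).2

lemma optValue_le_one {M : MDP X A H} (hM : BoundedReturn M) : optValue M ≤ 1 :=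
  Real.iSup_le (value_le_one hM) zero_le_one

/-- The simulation lemma: a policy has nearly the same value in the estimated model and, through the
decoder, in the environment. -/
lemma sq_value_sub_value_le {Mobs : MDP X A H} {M : MDP S A H} (hMobs : BoundedReturn Mobs)
    (hM : BoundedReturn M) (φ : Decoder X S H) (π : Policy S A H) :
    (value Mobs (π.comp φ) - value M π) ^ 2 ≤ 6 * expectedSelfPredErr Mobs M φ (π.comp φ) := by
  rw [value_eq_integral_min Mobs hMobs, value_eq_integral_min M hM, ← integral_trajErr,
    ← integral_const_mul]
  exact (hellingerControlled_traj Mobs M φ π).sq_sub_le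
    (measurable_compress.comp measurable_prodMk_left) measurable_min_ret min_ret_mem

lemma measurable_compressHistory_left {n : ℕ} (φ : Decoder X S H) :
    Measurable (compressHistory φ : (Fin n → Policy S A H × Traj X A H) → _) :=
  measurable_compressHistory.comp measurable_prodMk_left

lemma bddMeas_expectedSelfPredErr_run (Mobs : MDP X A H) (M : MDP S A H) (φ : Decoder X S H)
    (k : Fin (K + 1)) : BddMeas fun w : Fin (K + 1) → Policy S A H × Traj X A H =>
      expectedSelfPredErr Mobs M φ ((w k).1.comp φ) :=
  (bddMeas_expectedSelfPredErr Mobs).comp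
    (φ := fun w : Fin (K + 1) → Policy S A H × Traj X A H => ((M, φ), (w k).1.comp φ))
    (measurable_const.prodMk (measurable_policy_comp.comp
      (measurable_const.prodMk (measurable_fst.comp (measurable_pi_apply k)))))

/-- The `K + 1` episodes of a run have, in total, `K + 1` times the expected error of the selected
episode. -/
lemma sum_integral_expectedSelfPredErr (alg : BaseAlg S A H K) (Mobs : MDP X A H) (M : MDP S A H)
    (φ : Decoder X S H) :
    ∑ k, ∫ w, expectedSelfPredErr Mobs M φ ((w k).1.comp φ) ∂(runKernel alg Mobs φ) =
      ((K : ℝ) + 1) * ∫ π, expectedSelfPredErr Mobs M φ π ∂(selectPolicy alg Mobs (M, φ)) := by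
  have b : BddMeas fun π : Policy X A H => expectedSelfPredErr Mobs M φ π :=
    (bddMeas_expectedSelfPredErr Mobs).comp (measurable_prodMk_left (x := (M, φ)))
  rw [integral_selectPolicy alg Mobs (M, φ) b, mul_inv_cancel_left₀ (by positivity)]

/-- The risk of the base algorithm in compressed dynamics, measured in the estimated model, is close
to its risk in that model. -/
lemma sq_integral_risk_sub_expectedRisk_le (alg : BaseAlg S A H K) (Mobs : MDP X A H)
    {M : MDP S A H} (hM : BoundedReturn M) (φ : Decoder X S H) :
    (∫ w, (optValue M - value M (w (Fin.last K)).1) ∂(runKernel alg Mobs φ) -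
        expectedRisk alg M) ^ 2 ≤
      6 * (((K : ℝ) + 1) *
        ∫ π, expectedSelfPredErr Mobs M φ π ∂(selectPolicy alg Mobs (M, φ))) := by
  have hrun := hellingerControlled_run alg Mobs M φ
  have h := hrun.sq_sub_le (measurable_compressHistory_left φ)
    (f := fun w => optValue M - value M (w (Fin.last K)).1)
    (((BddMeas.const (optValue M)).sub ((bddMeas_value M).comp
      (measurable_fst.comp (measurable_pi_apply _)))).meas)
    (fun w => ⟨sub_nonneg.2 (value_le_optValue M _), by
      linarith [optValue_le_one hM, (value_mem M (w (Fin.last K)).1).1]⟩)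
  refine h.trans (le_of_eq ?_)
  have bt : ∀ k : Fin (K + 1), BddMeas fun w : Fin (K + 1) → Policy S A H × Traj X A H =>
      trajErr Mobs M φ (w k).2 := fun k =>
    (bddMeas_trajErr Mobs M φ).comp (measurable_snd.comp (measurable_pi_apply k))
  rw [integral_finsetSum _ fun k _ => ((bt k).const_mul 6).integrable _,
    ← sum_integral_expectedSelfPredErr, Finset.mul_sum]
  refine Finset.sum_congr rfl fun k _ => ?_
  rw [integral_const_mul, integral_runKernel_episode alg Mobs φ k
    ((bddMeas_trajErr Mobs M φ).comp measurable_snd)]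
  simp only [integral_trajErr]

/-- The expected risk of one epoch, given the estimate of the oracle. -/
lemma epoch_risk_le (alg : BaseAlg S A H K) {Mobs : MDP X A H} {M : MDP S A H}
    (hMobs : BoundedReturn Mobs) (hM : BoundedReturn M) (φ : Decoder X S H) {γ : ℝ} (hγ : 0 < γ) :
    optValue M - ∫ w, value Mobs ((w (Fin.last K)).1.comp φ) ∂(runKernel alg Mobs φ) ≤
      expectedRisk alg M +
        γ * ∫ π, expectedSelfPredErr Mobs M φ π ∂(selectPolicy alg Mobs (M, φ)) +
        6 * ((K : ℝ) + 1) / γ := by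
  have hK : (0 : ℝ) < (K : ℝ) + 1 := by positivity
  set a := ∫ π, expectedSelfPredErr Mobs M φ π ∂(selectPolicy alg Mobs (M, φ)) with ha
  set P := runKernel alg Mobs φ
  -- the weight makes the errors of the two comparisons sum to `γ a`
  have hl : 0 < γ / (2 * ((K : ℝ) + 1)) := by positivity
  have h1 := (abs_le.1 (abs_le_of_sq_le_six_mul
    (sq_integral_risk_sub_expectedRisk_le alg Mobs hM φ) hl)).2
  have bV : BddMeas fun w : Fin (K + 1) → Policy S A H × Traj X A H => value M (w (Fin.last K)).1 :=
    (bddMeas_value M).comp (measurable_fst.comp (measurable_pi_apply _))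
  have bO : BddMeas fun w : Fin (K + 1) → Policy S A H × Traj X A H =>
      value Mobs ((w (Fin.last K)).1.comp φ) :=
    (bddMeas_value Mobs).comp (measurable_policy_comp.comp
      (measurable_const.prodMk (measurable_fst.comp (measurable_pi_apply _))))
  have bE := bddMeas_expectedSelfPredErr_run (K := K) Mobs M φ (Fin.last K)
  have h2 : ∫ w, value M (w (Fin.last K)).1 ∂P - ∫ w, value Mobs ((w (Fin.last K)).1.comp φ) ∂P ≤
      γ / (2 * ((K : ℝ) + 1)) * (((K : ℝ) + 1) * a) + 3 / (2 * (γ / (2 * ((K : ℝ) + 1)))) := by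
    rw [← integral_sub (bV.integrable _) (bO.integrable _)]
    calc _ ≤ ∫ w, (γ / (2 * ((K : ℝ) + 1)) *
            expectedSelfPredErr Mobs M φ ((w (Fin.last K)).1.comp φ) +
          3 / (2 * (γ / (2 * ((K : ℝ) + 1))))) ∂P := by
          refine integral_mono ((bV.sub bO).integrable _)
            (((bE.const_mul _).add (BddMeas.const _)).integrable _) fun w => ?_
          have := (abs_le.1 (abs_le_of_sq_le_six_mul
            (sq_value_sub_value_le hMobs hM φ (w (Fin.last K)).1) hl)).1
          simp only
          linarith
      _ = γ / (2 * ((K : ℝ) + 1)) *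
            ∫ w, expectedSelfPredErr Mobs M φ ((w (Fin.last K)).1.comp φ) ∂P +
          3 / (2 * (γ / (2 * ((K : ℝ) + 1)))) := by
          rw [integral_add ((bE.const_mul _).integrable _) (integrable_const _), integral_const_mul]
          simp
      _ ≤ _ := by
          have hle : ∫ w, expectedSelfPredErr Mobs M φ ((w (Fin.last K)).1.comp φ) ∂P ≤
              ((K : ℝ) + 1) * a := by
            rw [ha, ← sum_integral_expectedSelfPredErr]
            exact Finset.single_le_sum (f := fun k => ∫ w, expectedSelfPredErr Mobs M φ
              ((w k).1.comp φ) ∂P)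
              (fun k _ => integral_nonneg fun w => expectedSelfPredErr_nonneg ..)
              (Finset.mem_univ (Fin.last K))
          gcongr
  rw [integral_sub (integrable_const _) (bV.integrable _)] at h1
  simp only [integral_const, probReal_univ, one_smul] at h1
  have e1 : γ / (2 * ((K : ℝ) + 1)) * (((K : ℝ) + 1) * a) = γ * a / 2 := by field_simp
  have e2 : 3 / (2 * (γ / (2 * ((K : ℝ) + 1)))) = 3 * ((K : ℝ) + 1) / γ := by field_simp
  have e3 : 6 * ((K : ℝ) + 1) / γ = 3 * ((K : ℝ) + 1) / γ + 3 * ((K : ℝ) + 1) / γ := by ring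
  rw [e1, e2] at h1 h2
  rw [e3]
  linarith

/-! ### The risk of the reduction and the regret of the oracle -/

lemma expectedRisk_nonneg (alg : BaseAlg S A H K) (M : MDP S A H) : 0 ≤ expectedRisk alg M :=
  integral_nonneg fun _ => sub_nonneg.2 (value_le_optValue M _)

lemma expectedRisk_le (alg : BaseAlg S A H K) (M : MDP S A H) : expectedRisk alg M ≤ H := by
  have b : BddMeas fun w : Fin (K + 1) → Policy S A H × Traj S A H => value M (w (Fin.last K)).1 :=
    (bddMeas_value M).comp (measurable_fst.comp (measurable_pi_apply _))
  exact (integral_mem_Icc (a := 0) ((BddMeas.const _).sub b).meas fun w =>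
    ⟨sub_nonneg.2 (value_le_optValue M _), by
      linarith [(optValue_mem M).2, (value_mem M (w (Fin.last K)).1).1]⟩).2

lemma expectedRisk_le_riskBase (alg : BaseAlg S A H K) {Mlat : Set (MDP S A H)} {M : MDP S A H}
    (hM : M ∈ Mlat) : expectedRisk alg M ≤ riskBase alg Mlat :=
  le_ciSup (f := fun M : Mlat => expectedRisk alg M.1)
    ⟨H, by rintro _ ⟨M, rfl⟩; exact expectedRisk_le alg _⟩ ⟨M, hM⟩

lemma riskBase_nonneg (alg : BaseAlg S A H K) (Mlat : Set (MDP S A H)) : 0 ≤ riskBase alg Mlat :=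
  Real.iSup_nonneg fun _ => expectedRisk_nonneg _ _

lemma bddMeas_epoch_value (Mobs : MDP X A H) : BddMeas fun r : Epoch X S A H K =>
    value Mobs (Policy.comp (r.2.1 (Fin.last K)).1 r.1.2) :=
  (bddMeas_value Mobs).comp (measurable_policy_comp.comp
    ((measurable_snd.comp measurable_fst).prodMk (measurable_fst.comp
      ((measurable_pi_apply _).comp (measurable_fst.comp measurable_snd)))))

lemma o2lExpectedRisk_le_regret [Nonempty A] (hT : 1 ≤ T) {Mlat : Set (MDP S A H)}
    {Φ : Set (Decoder X S H)} {Mstar : MDP S A H} {Mobs : MDP X A H}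
    (hlat : ∀ M ∈ Mlat, BoundedReturn M) (hMobs : BoundedReturn Mobs)
    (hopt : optValue Mobs ≤ optValue Mstar) (alg : BaseAlg S A H K) (rep : RepOracle X S A H T)
    (hrep : rep.Proper Mlat Φ) {γ : ℝ} (hγ : 0 < γ) :
    o2lExpectedRisk rep alg Mobs ≤ riskBase alg Mlat + 6 * ((K : ℝ) + 1) / γ +
      γ / T * ∫ w, optSelfPredRegret (Strategy.ofKernel T (selectPolicy alg Mobs)) Mstar Mobs γ w
        ∂(protocolLaw rep (Strategy.ofKernel T (selectPolicy alg Mobs)) Mobs) := by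
  have hT0 : (0 : ℝ) < T := by exact_mod_cast hT
  have iL := isProbabilityMeasure_o2lLaw rep alg Mobs
  set D := selectPolicy (S := S) alg Mobs with hD
  set R := roundRegret D Mstar Mobs γ with hR
  have bR : BddMeas R := bddMeas_roundRegret D Mstar Mobs γ
  set C := riskBase alg Mlat + 6 * ((K : ℝ) + 1) / γ with hC
  have bV := bddMeas_epoch_value (S := S) (K := K) Mobs
  have bg : BddMeas fun r : Epoch X S A H K =>
      optValue Mobs - value Mobs (Policy.comp (r.2.1 (Fin.last K)).1 r.1.2) :=
    (BddMeas.const _).sub bV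
  have bg' : BddMeas fun r : Epoch X S A H K => C + γ * R r.1 :=
    (BddMeas.const C).add ((bR.comp measurable_fst).const_mul γ)
  have hepoch : ∀ t : Fin T, ∫ w, (optValue Mobs -
      value Mobs (Policy.comp ((w t).2.1 (Fin.last K)).1 (w t).1.2)) ∂(o2lLaw rep alg Mobs) ≤
        ∫ w, (C + γ * R (w t).1) ∂(o2lLaw rep alg Mobs) := by
    intro t
    refine integral_historyKernel_mono (κ := epochKernel rep alg Mobs) (fun _ => inferInstance) ()
      bg bg' t (fun w => ?_) T le_rfl t.isLt
    rw [integral_epochKernel rep alg Mobs t w bg, integral_epochKernel rep alg Mobs t w bg']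
    have := rep.isMarkov t
    have ik : ∀ {F : Epoch X S A H K → ℝ}, BddMeas F →
        Integrable (fun e : MDP S A H × Decoder X S H =>
        ∫ y, F (e, y) ∂(runAndSelect alg Mobs e.2)) (rep.estimate t (oracleView w)) := fun hF =>
      (hF.integral_kernel ((runAndSelect alg Mobs).comap
        (Prod.snd : MDP S A H × Decoder X S H → _) measurable_snd)).integrable _
    refine integral_mono_ae (ik bg) (ik bg') ((hrep t (oracleView w)).mono fun e he => ?_)
    have hrun : ∫ y, (optValue Mobs - value Mobs (Policy.comp (y.1 (Fin.last K)).1 e.2))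
        ∂(runAndSelect alg Mobs e.2) = optValue Mobs -
          ∫ w, value Mobs ((w (Fin.last K)).1.comp e.2) ∂(runKernel alg Mobs e.2) := by
      have bw : BddMeas fun w : Fin (K + 1) → Policy S A H × Traj X A H =>
          value Mobs ((w (Fin.last K)).1.comp e.2) :=
        (bddMeas_value Mobs).comp (measurable_policy_comp.comp
          (measurable_const.prodMk (measurable_fst.comp (measurable_pi_apply _))))
      rw [integral_runAndSelect alg Mobs e.2 (((BddMeas.const _).sub bw).comp measurable_fst)]
      simp only [Finset.sum_const, Finset.card_univ, Fintype.card_fin, nsmul_eq_mul, Nat.cast_add,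
        Nat.cast_one]
      have hK : (K : ℝ) + 1 ≠ 0 := by positivity
      simp only [inv_mul_cancel_left₀ hK]
      rw [integral_sub (integrable_const _) (bw.integrable _)]
      simp
    simp only [hrun, integral_const, probReal_univ, one_smul]
    have h1 := epoch_risk_le alg hMobs (hlat e.1 he.1) e.2 hγ
    have h2 := expectedRisk_le_riskBase alg he.1
    have h3 : γ * R e = γ * ∫ π, expectedSelfPredErr Mobs e.1 e.2 π ∂(D e) +
        (optValue Mstar - optValue e.1) := by
      rw [hR, roundRegret, mul_add, mul_inv_cancel_left₀ hγ.ne']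
    rw [h3, hC]
    simp only [Prod.mk.eta] at h1
    linarith
  have hlaw : ∫ w, optSelfPredRegret (Strategy.ofKernel T D) Mstar Mobs γ w
      ∂(protocolLaw rep (Strategy.ofKernel T D) Mobs) =
        ∑ t : Fin T, ∫ w, R (w t).1 ∂(o2lLaw rep alg Mobs) := by
    rw [integral_optSelfPredRegret_ofKernel, protocolLaw_eq_map_o2lLaw]
    refine Finset.sum_congr rfl fun t _ => ?_
    have hm : Measurable fun (w : Fin T → Epoch X S A H K) t => Epoch.toRound (w t) :=
      measurable_pi_lambda _ fun t => measurable_toRound.comp (measurable_pi_apply t)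
    rw [integral_map hm.aemeasurable ((bR.comp measurable_fst).comp
      (measurable_pi_apply t)).meas.aestronglyMeasurable]
    rfl
  have iV : ∀ t : Fin T, Integrable (fun w : Fin T → Epoch X S A H K =>
      value Mobs (Policy.comp ((w t).2.1 (Fin.last K)).1 (w t).1.2))
        (o2lLaw rep alg Mobs) := fun t =>
    (bV.comp (measurable_pi_apply t)).integrable _
  have iR : ∀ t : Fin T, Integrable (fun w : Fin T → Epoch X S A H K => R (w t).1)
      (o2lLaw rep alg Mobs) := fun t =>
    ((bR.comp measurable_fst).comp (measurable_pi_apply t)).integrable _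
  have hsum := Finset.sum_le_sum fun t (_ : t ∈ Finset.univ) => hepoch t
  have e1 : ∀ t : Fin T, ∫ w, (optValue Mobs -
      value Mobs (Policy.comp ((w t).2.1 (Fin.last K)).1 (w t).1.2)) ∂(o2lLaw rep alg Mobs) =
      optValue Mobs - ∫ w, value Mobs (Policy.comp ((w t).2.1 (Fin.last K)).1 (w t).1.2)
        ∂(o2lLaw rep alg Mobs) := fun t => by
    rw [integral_sub (integrable_const _) (iV t)]; simp
  have e2 : ∀ t : Fin T, ∫ w, (C + γ * R (w t).1) ∂(o2lLaw rep alg Mobs) =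
      C + γ * ∫ w, R (w t).1 ∂(o2lLaw rep alg Mobs) := fun t => by
    rw [integral_add (integrable_const _) ((iR t).const_mul γ), integral_const_mul]; simp
  simp only [e1, e2, Finset.sum_sub_distrib, Finset.sum_add_distrib, ← Finset.mul_sum,
    Finset.sum_const, Finset.card_univ, Fintype.card_fin, nsmul_eq_mul] at hsum
  rw [← hlaw] at hsum
  have e3 : o2lExpectedRisk rep alg Mobs = optValue Mobs - (T : ℝ)⁻¹ *
      ∑ t, ∫ w, value Mobs (Policy.comp ((w t).2.1 (Fin.last K)).1 (w t).1.2)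
        ∂(o2lLaw rep alg Mobs) := by
    unfold o2lExpectedRisk o2lRisk
    rw [integral_sub (integrable_const _) ((integrable_finsetSum _ fun t _ => iV t).const_mul _),
      integral_const_mul, integral_finsetSum _ fun t _ => iV t]
    simp
  rw [e3]
  have h4 := mul_le_mul_of_nonneg_left hsum (inv_nonneg.2 hT0.le)
  rw [mul_sub, mul_add, inv_mul_cancel_left₀ hT0.ne', inv_mul_cancel_left₀ hT0.ne',
    ← mul_assoc] at h4
  rw [div_eq_inv_mul γ]
  exact h4

/-- Any regret bound that holds for all adaptive strategies is at least of order `- T / γ²`: the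
strategy that plays nearly optimal policies of the estimated models sees every over-optimistic
estimate as a self-predictive error. -/
lemma neg_le_of_regretBound [Nonempty A] {Mlat : Set (MDP S A H)}
    {Φ : Set (Decoder X S H)} {Mstar : MDP S A H} {Mobs : MDP X A H}
    (hlat : ∀ M ∈ Mlat, BoundedReturn M) (hMobs : BoundedReturn Mobs)
    (hopt : optValue Mobs ≤ optValue Mstar) (rep : RepOracle X S A H T)
    (hrep : rep.Proper Mlat Φ) {γ est : ℝ} (hγ : 0 < γ) (hest : RegretBound rep Mstar Mobs γ est) :
    -(5 / 2 * T / γ ^ 2) ≤ est := by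
  obtain ⟨sel, msel, hsel⟩ := exists_measurable_nearOptimal (X := S) (A := A) (H := H)
    (inv_pos.2 hγ)
  have mD : Measurable fun e : MDP S A H × Decoder X S H => Policy.comp (sel e.1) e.2 :=
    measurable_policy_comp.comp (measurable_snd.prodMk (msel.comp measurable_fst))
  set D := Kernel.deterministic _ mD with hD
  refine le_trans ?_ (hest (Strategy.ofKernel T D))
  rw [integral_optSelfPredRegret_ofKernel]
  have bR : BddMeas (roundRegret D Mstar Mobs γ) := bddMeas_roundRegret D Mstar Mobs γ
  have iP := isProbabilityMeasure_protocolLaw rep (Strategy.ofKernel T D) Mobs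
  have key : ∀ t : Fin T, -(5 / 2 / γ ^ 2) ≤ ∫ w, roundRegret D Mstar Mobs γ (w t).1
      ∂(protocolLaw rep (Strategy.ofKernel T D) Mobs) := by
    intro t
    have hc : ∫ w : Fin T → Round X S A H, -(5 / 2 / γ ^ 2)
        ∂(protocolLaw rep (Strategy.ofKernel T D) Mobs) =
        -(5 / 2 / γ ^ 2) := by simp
    rw [← hc]
    refine integral_historyKernel_mono (κ := roundKernel rep (Strategy.ofKernel T D) Mobs)
      (fun _ => inferInstance) () (BddMeas.const _) (bR.comp measurable_fst) t (fun w => ?_)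
      T le_rfl t.isLt
    rw [integral_roundKernel rep D Mobs t w (BddMeas.const _),
      integral_roundKernel rep D Mobs t w (bR.comp measurable_fst)]
    have := rep.isMarkov t
    simp only [integral_const, probReal_univ, one_smul]
    have hc' : ∫ e : MDP S A H × Decoder X S H, -(5 / 2 / γ ^ 2)
        ∂(rep.estimate t fun i => ((w i).1, (w i).2.2)) = -(5 / 2 / γ ^ 2) := by simp
    refine hc'.ge.trans (integral_mono_ae (integrable_const _) (bR.integrable _)
      ((hrep t _).mono fun e he => ?_))
    have hE : BddMeas fun π : Policy X A H => expectedSelfPredErr Mobs e.1 e.2 π :=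
      (bddMeas_expectedSelfPredErr Mobs).comp (measurable_prodMk_left (x := e))
    simp only [roundRegret]
    rw [hD, Kernel.deterministic_apply, integral_dirac' _ _ hE.meas.stronglyMeasurable]
    set s := expectedSelfPredErr Mobs e.1 e.2 (Policy.comp (sel e.1) e.2)
    have h1 := (abs_le.1 (abs_le_of_sq_le_six_mul
      (sq_value_sub_value_le hMobs (hlat e.1 he.1) e.2 (sel e.1)) hγ)).1
    have h2 := hsel e.1
    have h3 := value_le_optValue Mobs (Policy.comp (sel e.1) e.2)
    have h4 : -(γ * s + 3 / (2 * γ)) - γ⁻¹ ≤ optValue Mstar - optValue e.1 := by linarith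
    have h5 := mul_le_mul_of_nonneg_left h4 (inv_pos.2 hγ).le
    have e5 : γ⁻¹ * (-(γ * s + 3 / (2 * γ)) - γ⁻¹) = -s - 5 / 2 / γ ^ 2 := by
      field_simp; ring
    linarith
  have := Finset.sum_le_sum fun t (_ : t ∈ Finset.univ) => key t
  simp only [Finset.sum_const, Finset.card_univ, Fintype.card_fin, nsmul_eq_mul] at this
  refine le_trans (le_of_eq ?_) this
  ring

/-- The action space has a point because the base algorithm produces a policy. -/
lemma nonempty_action (hH : H ≠ 0) (M : MDP S A H) (alg : BaseAlg S A H K) : Nonempty A := by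
  have := alg.isMarkov 0
  obtain ⟨s⟩ : Nonempty S := nonempty_of_isProbabilityMeasure (M.init : Measure S)
  obtain ⟨π⟩ : Nonempty (Policy S A H) :=
    nonempty_of_isProbabilityMeasure (alg.policy 0 fun i => i.elim0)
  exact nonempty_of_isProbabilityMeasure (π ⟨0, Nat.pos_of_ne_zero hH⟩ s : Measure A)

/-- With horizon zero there are no rewards. -/
lemma o2lExpectedRisk_le_of_horizon_zero (hH : H = 0) {Mstar : MDP S A H} {Mobs : MDP X A H}
    (alg : BaseAlg S A H K) (rep : RepOracle X S A H T) {γ est : ℝ}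
    (hest : RegretBound rep Mstar Mobs γ est) : o2lExpectedRisk rep alg Mobs ≤ 0 ∧ 0 ≤ est := by
  have hH' : (H : ℝ) = 0 := by rw [hH]; simp
  constructor
  · refine integral_nonpos fun w => ?_
    have h1 := (optValue_mem Mobs).2
    have h2 : 0 ≤ ∑ t, value Mobs (Policy.comp ((w t).2.1 (Fin.last K)).1 (w t).1.2) :=
      Finset.sum_nonneg fun t _ => (value_mem Mobs _).1
    have h3 : 0 ≤ (T : ℝ)⁻¹ *
        ∑ t, value Mobs (Policy.comp ((w t).2.1 (Fin.last K)).1 (w t).1.2) := by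
      positivity
    simp only [o2lRisk, Pi.zero_apply]
    linarith
  · refine le_trans (integral_nonneg fun w => Finset.sum_nonneg fun t _ => ?_)
      (hest (Strategy.ofKernel T (selectPolicy alg Mobs)))
    have hz : ∀ M : MDP S A H, optValue M = 0 := fun M =>
      le_antisymm (hH' ▸ (optValue_mem M).2) (optValue_mem M).1
    rw [hz, hz, sub_zero, mul_zero, add_zero]
    exact integral_nonneg fun π => expectedSelfPredErr_nonneg ..

end Discrete

end LatentRL

theorem mainTheorem4 :
    ∃ c₁ c₂ c₃ : ℝ, 0 < c₁ ∧ 0 < c₂ ∧ 0 < c₃ ∧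
      ∀ (X : Type*) (S : Type*) (A : Type*)
        [MeasurableSpace X] [DiscreteMeasurableSpace X] [Countable X]
        [MeasurableSpace S] [DiscreteMeasurableSpace S] [Countable S]
        [MeasurableSpace A] [DiscreteMeasurableSpace A] [Countable A]
        (H K T : ℕ), 1 ≤ K → 1 ≤ T →
      ∀ (Mlat : Set (MDP S A H)) (Φ : Set (Decoder X S H))
        (Mstar : MDP S A H) (ψ : Emission S X H) (φstar : Decoder X S H),
        (∀ M ∈ Mlat, BoundedReturn M) →
        Decodable ψ → IsDecoder ψ φstar →
        BoundedReturn (latentDynamics Mstar ψ φstar) →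
      ∀ (alg : BaseAlg S A H K) (rep : RepOracle X S A H T) (γ : ℝ) (Est : ℕ → ℝ → ℝ),
        0 < γ →
        rep.Proper Mlat Φ →
        RegretBound rep Mstar (latentDynamics Mstar ψ φstar) γ (Est T γ) →
        o2lExpectedRisk rep alg (latentDynamics Mstar ψ φstar) ≤
          c₁ * riskBase alg Mlat + c₂ * γ * ((K : ℝ) / T) * Est T γ +
            c₃ * γ⁻¹ * (K * H) := by
  refine ⟨1, 1, 15, one_pos, one_pos, by norm_num, ?_⟩
  intro X S A _ _ _ _ _ _ _ _ _ H K T hK hT Mlat Φ Mstar ψ φstar hlat _ hφ hobs alg rep γ Est hγ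
    hrep hest
  have hK1 : (1 : ℝ) ≤ K := by exact_mod_cast hK
  have hT1 : (1 : ℝ) ≤ T := by exact_mod_cast hT
  rcases eq_or_ne H 0 with hH | hH
  · obtain ⟨h1, h2⟩ := o2lExpectedRisk_le_of_horizon_zero hH alg rep hest
    have h3 := riskBase_nonneg alg Mlat
    have h4 : 0 ≤ 1 * γ * ((K : ℝ) / T) * Est T γ := by positivity
    have h5 : 0 ≤ 15 * γ⁻¹ * ((K : ℝ) * H) := by positivity
    linarith
  have hH1 : (1 : ℝ) ≤ H := by exact_mod_cast Nat.one_le_iff_ne_zero.2 hH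
  have := nonempty_action hH Mstar alg
  have hopt := optValue_latentDynamics_le Mstar ψ φstar hφ
  have h1 := o2lExpectedRisk_le_regret hT hlat hobs hopt alg rep hrep hγ
  have h2 := mul_le_mul_of_nonneg_left
    (hest (Strategy.ofKernel T (selectPolicy alg (latentDynamics Mstar ψ φstar))))
    (show 0 ≤ γ / T by positivity)
  -- `est` may be negative; its lower bound pays for the factor `K` in front of it
  have h3 := mul_le_mul_of_nonneg_left
    (neg_le_of_regretBound hlat hobs hopt rep hrep hγ hest)
    (show 0 ≤ γ / T * ((K : ℝ) - 1) from mul_nonneg (by positivity) (by linarith))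
  have e3 : γ / T * ((K : ℝ) - 1) * -(5 / 2 * T / γ ^ 2) = -(5 / 2 * γ⁻¹ * (K - 1)) := by
    field_simp
  rw [e3] at h3
  have e4 : 6 * ((K : ℝ) + 1) / γ = 6 * γ⁻¹ * (K + 1) := by ring
  have e5 : 1 * γ * ((K : ℝ) / T) * Est T γ =
      γ / T * Est T γ + γ / T * ((K : ℝ) - 1) * Est T γ := by
    ring
  have hγ' : 0 < γ⁻¹ := inv_pos.2 hγ
  have h6 : 6 * γ⁻¹ * ((K : ℝ) + 1) + 5 / 2 * γ⁻¹ * (K - 1) ≤ 15 * γ⁻¹ * (K * H) := by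
    have h7 : (K : ℝ) ≤ K * H := by nlinarith
    nlinarith [mul_le_mul_of_nonneg_left h7 hγ'.le, mul_le_mul_of_nonneg_left hK1 hγ'.le]
  linarith
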